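/- Let $n\ge 1$, $\alpha,\beta>0$ and $h_1,\dots,h_{n-1}>0$; put $\lambda_0=\alpha$, $\lambda_k=h_k$ for $1\le k\le n-1$ and $\lambda_n=\beta$. **Clocks.** For a gap sequence $\xi=(\xi_i)_{i\in\mathbb Z}$ with $\xi_0\ge 0$, $\xi_i>0$ for $i\ne0$ and $\sum_{i\ge0}\xi_i=\sum_{i\ge1}\xi_{-i}=\infty$, let $Y_l(\xi)=\sum_{i=0}^{l}\xi_i$ for $l\ge0$ and $Y_l(\xi)=-\sum_{i=1}^{-l}\xi_{-i}$ for $l<0$. Let $\Omega$ be the set of all $\omega=(\omega_0,\dots,\omega_n)$ of $n+1$ such sequences whose jump times $T_{k,j}(\omega)=Y_j(\omega_k)$ satisfy $T_{k,j}\neq T_{k',j'}$ whenever $k\ne k'$, with the product $\sigma$-algebra and the measure $\mathbb P$ under which all the gaps are independent and those of $\omega_k$ are exponentially distributed with rate $\lambda_k$ (the product measure restricted to $\Omega$). For $t\in\mathbb R$ let $\theta_t\omega\in\Omega$ be obtained by translating all the jump times by $-t$ and renumbering each clock so that index $0$ belongs to its first nonnegative jump time. **Dynamics.** Let $X=\{0,1\}^n$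 with the discrete metric. For $x=(s_1,\dots,s_n)\in X$ and $k\in\{0,\dots,n\}$ let $f(x,k)$ be $x$ with $s_1$ replaced by $1$ if $k=0$; $x$ with $s_n$ replaced by $0$ if $k=n$; $x$ with $(s_k,s_{k+1})$ replaced by $(0,1)$ if $0<k<n$, $s_k=1$ and $s_{k+1}=0$; and $x$ otherwise. For $t\ge0$ let $\varphi(t,x,\omega)$ be the state obtained from $x$ by applying $f(\cdot,k)$ successively, in increasing order of time, for all jump times $T_{k,j}(\omega)\in[0,t)$. Let $$A(\omega)=\bigcap_{t\ge0}\varphi(t,X,\theta_{-t}\omega).$$ **Theorem.** 1. Under the measure $\mathbb P$ the $n+1$ clocks are independent, and the set $\Pi_k=\{T_{k,j}: j\in\mathbb Z\}$ of jump times of clock $k$ is a homogeneous Poisson process on $\mathbb R$ with rate $\lambda_k$: the counts $\#(\Pi_k\cap B)$, $B\subseteq\mathbb R$ Borel, are random variables with distribution $\mathrm{Pois}(\lambda_k|B|)$ (equal to $\infty$ a.s. if $|B|=\infty$), and counts in pairwise disjoint Borel sets are independent. Moreover $\Pi_k(\theta_t\omega)=\Pi_k(\omega)-t$ for all $t\in\mathbb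 R$ and all $\omega\in\Omega$. 2. $(\theta,\varphi)$ is a random dynamical system on $X$: $\mathbb P$ is a probability measure; $\theta_0=\mathrm{id}$, $\theta_{s+t}=\theta_s\circ\theta_t$, $(t,\omega)\mapsto\theta_t\omega$ is measurable and every $\theta_t$ preserves $\mathbb P$; $\varphi(0,x,\omega)=x$ and $\varphi(s+t,x,\omega)=\varphi(s,\varphi(t,x,\omega),\theta_t\omega)$ for all $s,t\ge 0$, $x$, $\omega$; $\varphi$ is measurable in $(t,x,\omega)$ and continuous in $x$. 3. $A$ is both a global random forward attractor and a global random pullback attractor: $\{(x,\omega):x\in A(\omega)\}$ is measurable in $X\times\Omega$ and every $A(\omega)$ is compact; almost surely $\varphi(t,A(\omega),\omega)=A(\theta_t\omega)$ for all $t\ge0$; and, with $\operatorname{dist}(B,C)=\sup_{b\in B}\inf_{c\in C}d(b,c)$, almost surely $$\lim_{t\to\infty}\operatorname{dist}\big(\varphi(t,X,\omega),A(\theta_t\omega)\big)=0\quad\text{and}\quad\lim_{t\to\infty}\operatorname{dist}\big(\varphi(t,X,\theta_{-t}\omega),A(\omega)\big)=0 .$$ 4. Almost surely, $A(\omega)$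 is a singleton. 5. All trajectories synchronize almost surely: for every $t_0\in\mathbb R$, for almost every $\omega$ there is $T\ge 0$ such that $\varphi(t,X,\theta_{t_0}\omega)$ is a singleton for all $t\ge T$. -/

import Mathlib

open MeasureTheory ProbabilityTheory Filter Topology
open scoped NNReal ENNReal

/-! ## Random dynamical systems and random attractors -/

namespace RDS

section General

variable {X Ω : Type*}

/-- An autonomous, measurable and measure-preserving dynamical system `θ` in two-sided
continuous time on the measure space `(Ω, P)`. -/
structure IsMeasurePreservingSystem [MeasurableSpace Ω] (P : Measure Ω) (θ : ℝ → Ω → Ω) :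
    Prop where
  zero : ∀ ω, θ 0 ω = ω
  add : ∀ s t ω, θ (s + t) ω = θ s (θ t ω)
  measurable : Measurable fun p : ℝ × Ω => θ p.1 p.2
  preserving : ∀ t, MeasurePreserving (θ t) P P

/-- A continuous time random dynamical system `(θ, φ)` on the space `X` over the probability
space `(Ω, P)`. -/
structure IsRDS [TopologicalSpace X] [MeasurableSpace X] [MeasurableSpace Ω] (P : Measure Ω)
    (θ : ℝ → Ω → Ω) (φ : ℝ≥0 → X → Ω → X) : Prop where
  isProbabilityMeasure : IsProbabilityMeasure P
  borelSpace : BorelSpace X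
  system : IsMeasurePreservingSystem P θ
  init : ∀ x ω, φ 0 x ω = x
  cocycle : ∀ (s t : ℝ≥0) x ω, φ (s + t) x ω = φ s (φ t x ω) (θ t ω)
  measurable : Measurable fun p : ℝ≥0 × X × Ω => φ p.1 p.2.1 p.2.2
  continuous : ∀ t ω, Continuous fun x => φ t x ω

/-- The Hausdorff semidistance `dist(A, B) = sup_{a ∈ A} inf_{b ∈ B} d(a, b)`. -/
noncomputable def semiDist [PseudoEMetricSpace X] (A B : Set X) : ℝ≥0∞ :=
  ⨆ a ∈ A, ⨅ b ∈ B, edist a b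

/-- A family of sections `A ω ⊆ X` is a compact random set: its graph in `X × Ω` is measurable
and all the sections are compact. -/
structure IsCompactRandomSet [TopologicalSpace X] [MeasurableSpace X] [MeasurableSpace Ω]
    (A : Ω → Set X) : Prop where
  measurable : MeasurableSet {p : X × Ω | p.1 ∈ A p.2}
  compact : ∀ ω, IsCompact (A ω)

/-- Strict `φ`-invariance: almost surely, `φ(t, A(ω), ω) = A(θ_t ω)` for all `t ≥ 0`. -/
def IsStrictlyInvariant [MeasurableSpace Ω] (P : Measure Ω)
    (θ : ℝ → Ω → Ω) (φ : ℝ≥0 → X → Ω → X) (A : Ω → Set X) : Prop :=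
  ∀ᵐ ω ∂P, ∀ t : ℝ≥0, (fun x => φ t x ω) '' A ω = A (θ t ω)

/-- Global random pullback attractor. -/
structure IsGlobalPullbackAttractor [PseudoEMetricSpace X] [MeasurableSpace X]
    [MeasurableSpace Ω] (P : Measure Ω) (θ : ℝ → Ω → Ω) (φ : ℝ≥0 → X → Ω → X)
    (A : Ω → Set X) : Prop where
  randomSet : IsCompactRandomSet A
  invariant : IsStrictlyInvariant P θ φ A
  attracts : ∀ᵐ ω ∂P, Tendsto
    (fun t : ℝ≥0 => semiDist (Set.range fun x => φ t x (θ (-(t : ℝ)) ω)) (A ω)) atTop (𝓝 0)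

/-- Global random forward attractor. -/
structure IsGlobalForwardAttractor [PseudoEMetricSpace X] [MeasurableSpace X]
    [MeasurableSpace Ω] (P : Measure Ω) (θ : ℝ → Ω → Ω) (φ : ℝ≥0 → X → Ω → X)
    (A : Ω → Set X) : Prop where
  randomSet : IsCompactRandomSet A
  invariant : IsStrictlyInvariant P θ φ A
  attracts : ∀ᵐ ω ∂P, Tendsto
    (fun t : ℝ≥0 => semiDist (Set.range fun x => φ t x ω) (A (θ t ω))) atTop (𝓝 0)

/-- The pullback limit set `A(ω) = ⋂_{t ≥ 0} φ(t, X, θ_{-t} ω)`. -/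
def pullbackLimit (θ : ℝ → Ω → Ω) (φ : ℝ≥0 → X → Ω → X) (ω : Ω) : Set X :=
  ⋂ t : ℝ≥0, Set.range fun x => φ t x (θ (-(t : ℝ)) ω)

end General

end RDS

/-- A homogeneous Poisson (point) process on the real line with rate `r`, in terms of the counts
`N(A) = #(Π ∩ A)`. A Poisson distribution with infinite mean is the point mass at `∞`. -/
structure IsHomogeneousPoissonProcess {Ω : Type*} [MeasurableSpace Ω] (P : Measure Ω)
    (pts : Ω → Set ℝ) (r : ℝ) : Prop where
  countable : ∀ ω, (pts ω).Countable
  measurable_count : ∀ A : Set ℝ, MeasurableSet A → Measurable fun ω => (pts ω ∩ A).encard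
  indep : ∀ (p : ℕ) (A : Fin p → Set ℝ), (∀ i, MeasurableSet (A i)) →
    (∀ i j, i ≠ j → Disjoint (A i) (A j)) → iIndepFun (fun i ω => (pts ω ∩ A i).encard) P
  law : ∀ A : Set ℝ, MeasurableSet A → volume A ≠ ∞ →
    P.map (fun ω => (pts ω ∩ A).encard) =
      (poissonMeasure (ENNReal.ofReal r * volume A).toNNReal).map ((↑) : ℕ → ℕ∞)
  law_infinite : ∀ A : Set ℝ, MeasurableSet A → volume A = ∞ →
    ∀ᵐ ω ∂P, (pts ω ∩ A).encard = ⊤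

/-! ## The TASEP random dynamical system -/

namespace TASEP

/-! ### States and hops -/

/-- The state space `{0,1}^n`; `x i` says whether site `i + 1` is occupied. -/
def State (n : ℕ) : Type := Fin n → Bool

instance (n : ℕ) : Fintype (State n) := inferInstanceAs (Fintype (Fin n → Bool))

instance (n : ℕ) : DecidableEq (State n) := inferInstanceAs (DecidableEq (Fin n → Bool))

instance (n : ℕ) : MeasurableSpace (State n) := ⊤

/-- The discrete metric on the state space. -/
instance (n : ℕ) : MetricSpace (State n) where
  dist x y := if x = y then 0 else 1
  dist_self x := by simp
  dist_comm x y := by simp [eq_comm]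
  dist_triangle x y z := by
    by_cases h1 : x = y <;> by_cases h2 : y = z <;> by_cases h3 : x = z <;> simp_all
  eq_of_dist_eq_zero := by
    intro x y h
    by_contra hne
    simp [hne] at h

/-- The effect `f(x, k)` of a jump attempt at site `k ∈ {0, …, n}`: for `k = 0` a particle enters
at site `1`, for `k = n` the particle at site `n` (if any) leaves, and otherwise a particle at
site `k` moves to site `k + 1` if that site is empty. -/
def hop {n : ℕ} (x : Fin n → Bool) (k : Fin (n + 1)) : Fin n → Bool := fun i =>
  if (k : ℕ) = 0 then (if (i : ℕ) + 1 = 1 then true else x i)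
  else if (k : ℕ) = n then (if (i : ℕ) + 1 = n then false else x i)
  else if ∃ a b : Fin n, (a : ℕ) + 1 = k ∧ (b : ℕ) + 1 = k + 1 ∧ x a = true ∧ x b = false then
    (if (i : ℕ) + 1 = k then false else if (i : ℕ) + 1 = k + 1 then true else x i)
  else x i

/-! ### A single clock -/

/-- The `l`-th jump time of the clock with gap sequence `ξ`: it is `∑_{i=0}^{l} ξ_i` for `l ≥ 0`
and `-∑_{i=1}^{-l} ξ_{-i}` for `l < 0` (`Int.negSucc l` is `-(l + 1)`). -/
noncomputable def jumpTime (ξ : ℤ → ℝ) : ℤ → ℝ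
  | Int.ofNat l => ∑ i ∈ Finset.range (l + 1), ξ (i : ℤ)
  | Int.negSucc l => -∑ i ∈ Finset.range (l + 1), ξ (-((i : ℤ) + 1))

/-- The admissible gap sequences. -/
structure IsClock (ξ : ℤ → ℝ) : Prop where
  nonneg_zero : 0 ≤ ξ 0
  pos : ∀ i, i ≠ 0 → 0 < ξ i
  sum_right : Tendsto (fun m : ℕ => ∑ i ∈ Finset.range m, ξ (i : ℤ)) atTop atTop
  sum_left : Tendsto (fun m : ℕ => ∑ i ∈ Finset.range m, ξ (-((i : ℤ) + 1))) atTop atTop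

/-- The set of jump times. -/
def points (ξ : ℤ → ℝ) : Set ℝ := Set.range (jumpTime ξ)

/-- The gap sequence of a sequence of times, inverse to `jumpTime`. -/
def gaps (b : ℤ → ℝ) : ℤ → ℝ
  | Int.ofNat 0 => b 0
  | Int.ofNat (l + 1) => b ((l : ℤ) + 1) - b (l : ℤ)
  | Int.negSucc 0 => -b (-1)
  | Int.negSucc (l + 1) => b (Int.negSucc l) - b (Int.negSucc (l + 1))

/-- The index of the first jump time in `[t, ∞)`. -/
noncomputable def firstIndex (ξ : ℤ → ℝ) (t : ℝ) : ℤ := sInf {l : ℤ | t ≤ jumpTime ξ l}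

/-- The clock seen from time `t`: all jump times are translated by `-t`, and renumbered in such a
way that index `0` belongs to the first nonnegative one. -/
noncomputable def shiftClock (t : ℝ) (ξ : ℤ → ℝ) : ℤ → ℝ :=
  gaps fun l => jumpTime ξ (l + firstIndex ξ t) - t

theorem jumpTime_gaps (b : ℤ → ℝ) (l : ℤ) : jumpTime (gaps b) l = b l := by
  cases l with
  | ofNat l =>
    induction l with
    | zero => simp [jumpTime, gaps]
    | succ l ih =>
      simp only [jumpTime] at ih ⊢
      rw [Finset.sum_range_succ, ih]
      have : gaps b ((l + 1 : ℕ) : ℤ) = b ((l : ℤ) + 1) - b (l : ℤ) := rfl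
      rw [this]
      have h2 : (Int.ofNat (l + 1)) = (l : ℤ) + 1 := rfl
      rw [h2]
      simp
  | negSucc l =>
    induction l with
    | zero =>
      have : gaps b (-1) = -b (-1) := rfl
      simp [jumpTime, this]
    | succ l ih =>
      simp only [jumpTime] at ih ⊢
      rw [Finset.sum_range_succ, neg_add, ih]
      have h1 : (-(((l + 1 : ℕ) : ℤ) + 1)) = Int.negSucc (l + 1) := by
        rw [Int.negSucc_eq]
      rw [h1]
      simp [gaps]

namespace IsClock

variable {ξ : ℤ → ℝ}

theorem tendsto_ofNat (h : IsClock ξ) :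
    Tendsto (fun l : ℕ => jumpTime ξ (l : ℤ)) atTop atTop :=
  h.sum_right.comp (tendsto_add_atTop_nat 1)

theorem tendsto_negSucc (h : IsClock ξ) :
    Tendsto (fun l : ℕ => jumpTime ξ (Int.negSucc l)) atTop atBot :=
  tendsto_neg_atTop_atBot.comp (h.sum_left.comp (tendsto_add_atTop_nat 1))

theorem strictMono (h : IsClock ξ) : StrictMono (jumpTime ξ) := by
  refine strictMono_int_of_lt_succ fun l => ?_
  cases l with
  | ofNat l =>
    have : jumpTime ξ (Int.ofNat l + 1) = jumpTime ξ (Int.ofNat l) + ξ ((l : ℤ) + 1) := by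
      change ∑ i ∈ Finset.range (l + 1 + 1), ξ (i : ℤ) = _
      rw [Finset.sum_range_succ]
      simp [jumpTime]
    rw [this]
    have := h.pos ((l : ℤ) + 1) (by omega)
    linarith
  | negSucc l =>
    cases l with
    | zero =>
      have h1 := h.pos (-1) (by omega)
      have h2 := h.nonneg_zero
      change jumpTime ξ (Int.negSucc 0) < jumpTime ξ (Int.ofNat 0)
      simp [jumpTime]
      linarith
    | succ l =>
      have h1 := h.pos (-(((l + 1 : ℕ) : ℤ) + 1)) (by omega)
      have h2 : Int.negSucc (l + 1) + 1 = Int.negSucc l := by omega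
      rw [h2]
      simp only [jumpTime]
      rw [Finset.sum_range_succ _ (l + 1)]
      linarith

theorem nonneg_iff (h : IsClock ξ) (l : ℤ) : 0 ≤ jumpTime ξ l ↔ 0 ≤ l := by
  constructor
  · intro hl
    by_contra hneg
    have h1 : jumpTime ξ l ≤ jumpTime ξ (-1) := h.strictMono.monotone (by omega)
    have h2 : jumpTime ξ (-1) = -ξ (-1) := by
      change jumpTime ξ (Int.negSucc 0) = _
      simp [jumpTime]
    have h3 := h.pos (-1) (by omega)
    linarith
  · intro hl
    have h1 : jumpTime ξ 0 ≤ jumpTime ξ l := h.strictMono.monotone hl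
    have h2 : jumpTime ξ 0 = ξ 0 := by
      change jumpTime ξ (Int.ofNat 0) = _
      simp [jumpTime]
    have h3 := h.nonneg_zero
    linarith

theorem exists_le (h : IsClock ξ) (t : ℝ) : ∃ l, t ≤ jumpTime ξ l := by
  obtain ⟨l, hl⟩ := (h.tendsto_ofNat.eventually_ge_atTop t).exists
  exact ⟨l, hl⟩

theorem bddBelow (h : IsClock ξ) (t : ℝ) : BddBelow {l : ℤ | t ≤ jumpTime ξ l} := by
  obtain ⟨m, hm⟩ := (h.tendsto_negSucc.eventually_lt_atBot t).exists
  refine ⟨Int.negSucc m, fun l hl => ?_⟩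
  by_contra hlt
  have h1 := h.strictMono (not_le.mp hlt)
  have h2 : t ≤ jumpTime ξ l := hl
  linarith

theorem firstIndex_le_iff (h : IsClock ξ) (t : ℝ) (l : ℤ) :
    firstIndex ξ t ≤ l ↔ t ≤ jumpTime ξ l := by
  constructor
  · intro hl
    have h1 : t ≤ jumpTime ξ (firstIndex ξ t) := Int.csInf_mem (h.exists_le t) (h.bddBelow t)
    exact h1.trans (h.strictMono.monotone hl)
  · intro hl
    exact csInf_le (h.bddBelow t) hl

theorem shift (h : IsClock ξ) (t : ℝ) : IsClock (shiftClock t ξ) := by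
  set b : ℤ → ℝ := fun l => jumpTime ξ (l + firstIndex ξ t) - t with hb
  have hmono : StrictMono b := fun i j hij => by
    have := h.strictMono (show i + firstIndex ξ t < j + firstIndex ξ t by omega)
    simp only [hb]
    linarith
  have h0 : 0 ≤ b 0 := by
    have := (h.firstIndex_le_iff t (0 + firstIndex ξ t)).1 (by omega)
    simp only [hb]
    linarith
  have h1 : b (-1) < 0 := by
    have := mt (h.firstIndex_le_iff t (-1 + firstIndex ξ t)).2 (by omega)
    simp only [hb]
    linarith
  have hup : ∀ c, ∃ l, c ≤ b l := fun c => by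
    obtain ⟨l, hl⟩ := h.exists_le (c + t)
    refine ⟨l - firstIndex ξ t, ?_⟩
    simp only [hb, sub_add_cancel]
    linarith
  have hdown : ∀ c, ∃ l, b l ≤ c := fun c => by
    obtain ⟨m, hm⟩ := (h.tendsto_negSucc.eventually_le_atBot (c + t)).exists
    refine ⟨Int.negSucc m - firstIndex ξ t, ?_⟩
    simp only [hb, sub_add_cancel]
    linarith
  change IsClock (gaps b)
  refine ⟨h0, ?_, ?_, ?_⟩
  · intro i hi
    match i, hi with
    | Int.ofNat 0, hi => exact absurd rfl hi
    | Int.ofNat (l + 1), _ =>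
      have := hmono (show (l : ℤ) < (l : ℤ) + 1 by omega)
      simp only [gaps]
      linarith
    | Int.negSucc 0, _ =>
      simp only [gaps]
      linarith
    | Int.negSucc (l + 1), _ =>
      have := hmono (show Int.negSucc (l + 1) < Int.negSucc l by omega)
      simp only [gaps]
      linarith
  · rw [← tendsto_add_atTop_iff_nat 1]
    have h2 : (fun m : ℕ => ∑ i ∈ Finset.range (m + 1), gaps b (i : ℤ)) = fun m : ℕ => b m :=
      funext fun m => jumpTime_gaps b (Int.ofNat m)
    rw [h2]
    refine tendsto_atTop_atTop.2 fun c => ?_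
    obtain ⟨l, hl⟩ := hup c
    exact ⟨l.toNat, fun m hm => hl.trans (hmono.monotone (by omega))⟩
  · rw [← tendsto_add_atTop_iff_nat 1]
    have h2 : (fun m : ℕ => ∑ i ∈ Finset.range (m + 1), gaps b (-((i : ℤ) + 1)))
        = fun m : ℕ => -b (Int.negSucc m) := by
      funext m
      rw [← jumpTime_gaps b (Int.negSucc m)]
      simp [jumpTime]
    rw [h2]
    refine tendsto_atTop_atTop.2 fun c => ?_
    obtain ⟨l, hl⟩ := hdown (-c)
    refine ⟨l.natAbs, fun m hm => ?_⟩
    have : b (Int.negSucc m) ≤ b l := hmono.monotone (by omega)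
    linarith

end IsClock

/-! ### The driving system -/

/-- The rates of the `n + 1` clocks: `α` (entry), `h 1, …, h (n - 1)`, `β` (exit). -/
def rate (n : ℕ) (α β : ℝ) (h : ℕ → ℝ) (k : Fin (n + 1)) : ℝ :=
  if (k : ℕ) = 0 then α else if (k : ℕ) = n then β else h k

/-- A family of `n + 1` clocks of which no two ever ring at the same time. -/
structure IsAdmissible {n : ℕ} (ω : Fin (n + 1) → ℤ → ℝ) : Prop where
  clock : ∀ k, IsClock (ω k)
  distinct : ∀ k k', k ≠ k' → ∀ j j', jumpTime (ω k) j ≠ jumpTime (ω k') j'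

/-- The sample space. -/
abbrev Sample (n : ℕ) : Type := {ω : Fin (n + 1) → ℤ → ℝ // IsAdmissible ω}

/-- The law of the clocks: all the gaps are independent, and those of clock `k` are exponentially
distributed with its rate. The product measure is restricted to the admissible families. -/
noncomputable def law (n : ℕ) (α β : ℝ) (h : ℕ → ℝ) : Measure (Sample n) :=
  (Measure.pi fun k : Fin (n + 1) =>
    Measure.infinitePi fun _ : ℤ => expMeasure (rate n α β h k)).comap Subtype.val

theorem IsAdmissible.shift {n : ℕ} {ω : Fin (n + 1) → ℤ → ℝ} (hω : IsAdmissible ω) (t : ℝ) :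
    IsAdmissible fun k => shiftClock t (ω k) := by
  refine ⟨fun k => (hω.clock k).shift t, fun k k' hk j j' heq => ?_⟩
  simp only [shiftClock, jumpTime_gaps] at heq
  exact hω.distinct k k' hk _ _ (sub_left_injective heq)

/-- The shift of all clocks by time `t`. -/
noncomputable def θ {n : ℕ} (t : ℝ) (ω : Sample n) : Sample n :=
  ⟨fun k => shiftClock t (ω.1 k), ω.2.shift t⟩

/-! ### The cocycle -/

/-- The jump times of all clocks in `[0, t)`. -/
def jumpSet {n : ℕ} (ω : Sample n) (t : ℝ) : Set ℝ :=
  {s | 0 ≤ s ∧ s < t ∧ ∃ k, s ∈ points (ω.1 k)}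

theorem jumpSet_finite {n : ℕ} (ω : Sample n) (t : ℝ) : (jumpSet ω t).Finite := by
  refine (Set.finite_iUnion fun k : Fin (n + 1) =>
    (Set.finite_Ico (0 : ℤ) (firstIndex (ω.1 k) t)).image (jumpTime (ω.1 k))).subset ?_
  rintro s ⟨h0, h1, k, j, rfl⟩
  have hc := ω.2.clock k
  refine Set.mem_iUnion.2 ⟨k, j, ⟨(hc.nonneg_iff j).1 h0, ?_⟩, rfl⟩
  by_contra hlt
  have := (hc.firstIndex_le_iff t j).1 (not_lt.1 hlt)
  linarith

/-- The clock that rings at the jump time `s` (it is unique; arbitrary if there is none). -/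
noncomputable def siteAt {n : ℕ} (ω : Sample n) (s : ℝ) : Fin (n + 1) :=
  Classical.epsilon fun k => s ∈ points (ω.1 k)

/-- The jump times in `[0, t)`, in increasing order. -/
noncomputable def jumpList {n : ℕ} (ω : Sample n) (t : ℝ) : List ℝ :=
  (jumpSet_finite ω t).toFinset.sort (· ≤ ·)

/-- The TASEP cocycle: starting from `x`, all jump attempts in `[0, t)` are carried out one after
the other in the order of their times. -/
noncomputable def φ {n : ℕ} (t : ℝ≥0) (x : State n) (ω : Sample n) : State n :=
  (jumpList ω t).foldl (fun (y : State n) s => (hop y (siteAt ω s) : State n)) x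

end TASEP

/-! The state space is finite, so the pullback images `φ(t, X, θ_{-t} ω)`, which decrease in `t`,
are eventually constant. This alone gives nonemptiness, strict invariance and pullback attraction
for every `ω` (`exists_range_eq_pullbackLimit`, `image_pullbackLimit`).

Synchronization comes from a word in the clock labels that drives every configuration to the full
one: particles are fed in from the left and pushed to the right end, and the exit is never used
(`exists_synchronizing_word`). In each block of consecutive unit intervals the clocks ring in the
pattern of this word with the same positive probability, and disjoint blocks are independent, so by
Borel-Cantelli some future block and some past block spell it (`ae_exists_spells`). A future block
makes all trajectories merge, whence forward attraction. A past block makes `A(ω)` a singleton.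

It remains to show that clocks built from exponential gaps are Poisson processes and that the shift
preserves their law. The central formula is that the expectation of `∏ (1 - g(T_l))` over all jump
times is `exp(-r ∫ g)` (`tendsto_integral_jumpProd`). On each half-line it comes from a martingale:
with `G(t) = exp(-r ∫_t^∞ g)`, the partial product times `G` of the last renewal time has constant
expectation, because `G(t)` is the mean of `(1 - g(t + S)) G(t + S)` for an exponential gap `S`
(`integral_expTail`). Taking `1 - g` equal to `z` on a set yields finiteness or infiniteness of
counts. Taking it unimodular yields joint characteristic functions, hence Poisson laws and
independence. Translation invariance of `∫ g` yields invariance under the shift. -/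

namespace RDS

/-! ### Pullback limits of a cocycle on a finite set -/

variable {X Ω : Type*} {θ : ℝ → Ω → Ω} {φ : ℝ≥0 → X → Ω → X}

/-- A run over `[-t, 0]` ends with a run over `[-s, 0]`, so an earlier start only restricts the
states available at time `-s`. -/
theorem range_pullback_antitone (hadd : ∀ s t ω, θ (s + t) ω = θ s (θ t ω))
    (hc : ∀ (s t : ℝ≥0) x ω, φ (s + t) x ω = φ s (φ t x ω) (θ t ω)) (ω : Ω) :
    Antitone fun t : ℝ≥0 => Set.range fun x => φ t x (θ (-(t : ℝ)) ω) := by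
  rintro s t hst _ ⟨x, rfl⟩
  have h1 : t = s + (t - s) := (add_tsub_cancel_of_le hst).symm
  have h2 : θ (-(s : ℝ)) ω = θ ((t - s : ℝ≥0) : ℝ) (θ (-(t : ℝ)) ω) := by
    rw [← hadd, NNReal.coe_sub hst]
    congr 1
    ring
  refine ⟨φ (t - s) x (θ (-(t : ℝ)) ω), ?_⟩
  change φ s _ _ = φ t _ _
  rw [h2, ← hc, ← h1]

/-- A decreasing family of subsets of a finite set stabilizes; `T` is a time at which the
cardinality is least. -/
theorem exists_range_eq_pullbackLimit [Finite X] (hadd : ∀ s t ω, θ (s + t) ω = θ s (θ t ω))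
    (hc : ∀ (s t : ℝ≥0) x ω, φ (s + t) x ω = φ s (φ t x ω) (θ t ω)) (ω : Ω) :
    ∃ T : ℝ≥0, ∀ t, T ≤ t →
      Set.range (fun x => φ t x (θ (-(t : ℝ)) ω)) = pullbackLimit θ φ ω := by
  have hanti := range_pullback_antitone hadd hc ω
  set R : ℝ≥0 → Set X := fun t => Set.range fun x => φ t x (θ (-(t : ℝ)) ω) with hR
  obtain ⟨T, hT⟩ : ∃ T, ∀ s, (R T).ncard ≤ (R s).ncard := by
    exact ⟨Function.argmin fun t => (R t).ncard, fun s => Function.argmin_le (fun t => (R t).ncard) s⟩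
  have key : ∀ t, T ≤ t → R t = R T := fun t ht =>
    Set.eq_of_subset_of_ncard_le (hanti ht) (hT t) (Set.toFinite _)
  refine ⟨T, fun t ht => ?_⟩
  refine Set.Subset.antisymm (Set.subset_iInter fun s => ?_) (Set.iInter_subset _ t)
  change R t ⊆ R s
  rw [key t ht, ← key (max T s) (le_max_left _ _)]
  exact hanti (le_max_right _ _)

/-- Monotonicity reduces to integer times, which makes membership in the limit a countable, hence
measurable, condition. -/
theorem pullbackLimit_eq_iInter_nat (hadd : ∀ s t ω, θ (s + t) ω = θ s (θ t ω))
    (hc : ∀ (s t : ℝ≥0) x ω, φ (s + t) x ω = φ s (φ t x ω) (θ t ω)) (ω : Ω) :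
    pullbackLimit θ φ ω =
      ⋂ m : ℕ, Set.range fun x => φ (m : ℝ≥0) x (θ (-(((m : ℝ≥0)) : ℝ)) ω) := by
  refine Set.Subset.antisymm (Set.subset_iInter fun m => Set.iInter_subset _ (m : ℝ≥0))
    (Set.subset_iInter fun t => ?_)
  obtain ⟨m, hm⟩ := exists_nat_ge t
  exact (Set.iInter_subset _ m).trans (range_pullback_antitone hadd hc ω hm)

theorem pullbackLimit_nonempty [Finite X] [Nonempty X]
    (hadd : ∀ s t ω, θ (s + t) ω = θ s (θ t ω))
    (hc : ∀ (s t : ℝ≥0) x ω, φ (s + t) x ω = φ s (φ t x ω) (θ t ω)) (ω : Ω) :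
    (pullbackLimit θ φ ω).Nonempty := by
  obtain ⟨T, hT⟩ := exists_range_eq_pullbackLimit hadd hc ω
  rw [← hT T le_rfl]
  exact Set.range_nonempty _

/-- For large `s` both limits are images of `X` from one and the same starting time: `-s` as seen
from `ω` is `-(t + s)` as seen from `θ t ω`. The cocycle property then links the two images. -/
theorem image_pullbackLimit [Finite X] (hzero : ∀ ω, θ 0 ω = ω)
    (hadd : ∀ s t ω, θ (s + t) ω = θ s (θ t ω))
    (hc : ∀ (s t : ℝ≥0) x ω, φ (s + t) x ω = φ s (φ t x ω) (θ t ω)) (ω : Ω) (t : ℝ≥0) :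
    (fun x => φ t x ω) '' pullbackLimit θ φ ω = pullbackLimit θ φ (θ t ω) := by
  obtain ⟨T, hT⟩ := exists_range_eq_pullbackLimit hadd hc ω
  obtain ⟨T', hT'⟩ := exists_range_eq_pullbackLimit hadd hc (θ t ω)
  set s := max T T'
  rw [← hT s (le_max_left _ _), ← hT' (t + s) ((le_max_right _ _).trans le_add_self),
    ← Set.range_comp]
  have h1 : θ (-((t + s : ℝ≥0) : ℝ)) (θ t ω) = θ (-(s : ℝ)) ω := by
    rw [← hadd]
    congr 1
    push_cast
    ring
  rw [h1]
  congr 1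
  funext x
  rw [hc, ← hadd, add_neg_cancel, hzero]
  rfl

end RDS

/-! ### The shift as a flow on clocks -/

namespace TASEP

/-- Together with `jumpTime_gaps` this makes gaps and jump times equivalent coordinates. Identities
between clocks can be checked on jump times, where a shift is a translation and a renumbering. -/
theorem gaps_jumpTime (ξ : ℤ → ℝ) : gaps (jumpTime ξ) = ξ := by
  funext l
  match l with
  | Int.ofNat 0 => simp [gaps, jumpTime]
  | Int.ofNat (l + 1) =>
    change jumpTime ξ (Int.ofNat (l + 1)) - jumpTime ξ (Int.ofNat l) = _
    simp [jumpTime, Finset.sum_range_succ _ (l + 1)]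
  | Int.negSucc 0 =>
    change -jumpTime ξ (Int.negSucc 0) = _
    simp [jumpTime]
  | Int.negSucc (l + 1) =>
    change jumpTime ξ (Int.negSucc l) - jumpTime ξ (Int.negSucc (l + 1)) = _
    simp only [jumpTime]
    rw [Finset.sum_range_succ _ (l + 1), Int.negSucc_eq]
    push_cast
    ring

theorem jumpTime_injective : Function.Injective jumpTime :=
  Function.LeftInverse.injective gaps_jumpTime

theorem jumpTime_shiftClock (t : ℝ) (ξ : ℤ → ℝ) (l : ℤ) :
    jumpTime (shiftClock t ξ) l = jumpTime ξ (l + firstIndex ξ t) - t :=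
  jumpTime_gaps _ l

theorem points_shiftClock (t : ℝ) (ξ : ℤ → ℝ) :
    points (shiftClock t ξ) = (fun s => s - t) '' points ξ := by
  ext s
  constructor
  · rintro ⟨l, rfl⟩
    exact ⟨_, ⟨l + firstIndex ξ t, rfl⟩, (jumpTime_shiftClock t ξ l).symm⟩
  · rintro ⟨_, ⟨l, rfl⟩, rfl⟩
    exact ⟨l - firstIndex ξ t, by simp [jumpTime_shiftClock]⟩

theorem mem_points_shiftClock {t s : ℝ} {ξ : ℤ → ℝ} :
    s ∈ points (shiftClock t ξ) ↔ s + t ∈ points ξ := by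
  rw [points_shiftClock]
  constructor
  · rintro ⟨r, hr, rfl⟩
    simpa using hr
  · exact fun h => ⟨s + t, h, by simp⟩

theorem IsClock.firstIndex_zero {ξ : ℤ → ℝ} (h : IsClock ξ) : firstIndex ξ 0 = 0 :=
  eq_of_forall_ge_iff fun l => (h.firstIndex_le_iff 0 l).trans (h.nonneg_iff l)

/-- An integer is determined by the integers above it, and `firstIndex_le_iff` describes these.
Additivity of the index is what lets renumberings compose in `θ_add`. -/
theorem IsClock.firstIndex_shiftClock {ξ : ℤ → ℝ} (h : IsClock ξ) (s t : ℝ) :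
    firstIndex (shiftClock t ξ) s = firstIndex ξ (s + t) - firstIndex ξ t :=
  eq_of_forall_ge_iff fun l => by
    rw [(h.shift t).firstIndex_le_iff, jumpTime_shiftClock, le_sub_iff_add_le,
      ← h.firstIndex_le_iff]
    omega

variable {n : ℕ}

theorem θ_zero (ω : Sample n) : θ 0 ω = ω := by
  refine Subtype.ext (funext fun k => jumpTime_injective (funext fun l => ?_))
  change jumpTime (shiftClock 0 (ω.1 k)) l = _
  simp [jumpTime_shiftClock, (ω.2.clock k).firstIndex_zero]

theorem θ_add (s t : ℝ) (ω : Sample n) : θ (s + t) ω = θ s (θ t ω) := by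
  refine Subtype.ext (funext fun k => jumpTime_injective (funext fun l => ?_))
  change jumpTime (shiftClock (s + t) (ω.1 k)) l =
    jumpTime (shiftClock s (shiftClock t (ω.1 k))) l
  rw [jumpTime_shiftClock, jumpTime_shiftClock, jumpTime_shiftClock,
    (ω.2.clock k).firstIndex_shiftClock]
  rw [show l + (firstIndex (ω.1 k) (s + t) - firstIndex (ω.1 k) t) + firstIndex (ω.1 k) t =
    l + firstIndex (ω.1 k) (s + t) by ring]
  ring

/-! ### The cocycle property and lists of jumps -/

theorem siteAt_jumpTime (ω : Sample n) (k : Fin (n + 1)) (j : ℤ) :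
    siteAt ω (jumpTime (ω.1 k) j) = k := by
  obtain ⟨j', hj'⟩ := Classical.epsilon_spec (p := fun k' => jumpTime (ω.1 k) j ∈ points (ω.1 k'))
    ⟨k, j, rfl⟩
  by_contra hne
  exact ω.2.distinct _ _ hne j' j hj'

theorem siteAt_θ (t s : ℝ) (ω : Sample n) : siteAt (θ t ω) s = siteAt ω (s + t) :=
  congrArg Classical.epsilon (funext fun _ => propext mem_points_shiftClock)

theorem mem_jumpList {ω : Sample n} {t s : ℝ} : s ∈ jumpList ω t ↔ s ∈ jumpSet ω t := by
  simp [jumpList]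

theorem jumpList_eq {ω : Sample n} {t : ℝ} {L : List ℝ} (hs : L.SortedLT)
    (hm : ∀ s, s ∈ L ↔ s ∈ jumpSet ω t) : jumpList ω t = L :=
  List.SortedLT.eq_of_mem_iff (Finset.sortedLT_sort _) hs fun s => by
    rw [hm]; exact mem_jumpList

theorem mem_jumpSet_θ {ω : Sample n} {t : ℝ≥0} {s r : ℝ} :
    r ∈ jumpSet (θ t ω) s ↔ 0 ≤ r ∧ r + t ∈ jumpSet ω (s + t) := by
  have ht := t.2
  constructor
  · rintro ⟨h0, h1, k, hk⟩
    exact ⟨h0, add_nonneg h0 ht, by linarith, k, mem_points_shiftClock.1 hk⟩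
  · rintro ⟨h0, _, h1, k, hk⟩
    exact ⟨h0, by linarith, k, mem_points_shiftClock.2 hk⟩

/-- The interval `[0, s + t)` splits into `[0, t)` and `[t, s + t)`; a ring exactly at `t` belongs
to the second piece only. -/
theorem jumpList_add (s t : ℝ≥0) (ω : Sample n) :
    jumpList ω (s + t) = jumpList ω t ++ (jumpList (θ t ω) s).map (· + (t : ℝ)) := by
  have hs := s.2
  have ht := t.2
  refine jumpList_eq (List.sortedLT_iff_pairwise.2 (List.pairwise_append.2
    ⟨List.sortedLT_iff_pairwise.1 (Finset.sortedLT_sort _), ?_, ?_⟩)) fun r => ?_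
  · refine List.pairwise_map.2 ((List.sortedLT_iff_pairwise.1 (Finset.sortedLT_sort _)).imp ?_)
    intro a b hab
    simpa using hab
  · intro a ha b hb
    obtain ⟨c, hc, rfl⟩ := List.mem_map.1 hb
    have h1 := (mem_jumpList.1 ha).2.1
    have h2 := (mem_jumpList.1 hc).1
    linarith
  · rw [List.mem_append, List.mem_map, mem_jumpList]
    constructor
    · rintro (⟨h0, h1, h2⟩ | ⟨c, hc, rfl⟩)
      · refine ⟨h0, ?_, h2⟩
        have : (0 : ℝ) ≤ s := hs
        linarith
      · exact (mem_jumpSet_θ.1 (mem_jumpList.1 hc)).2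
    · rintro ⟨h0, h1, h2⟩
      rcases lt_or_ge r t with h | h
      · exact Or.inl ⟨h0, h, h2⟩
      · exact Or.inr ⟨r - t, mem_jumpList.2 (mem_jumpSet_θ.2
          ⟨by linarith, by simpa using ⟨h0, h1, h2⟩⟩), by simp⟩

/-- The map `hop` on states. -/
def hopState (x : State n) (k : Fin (n + 1)) : State n := hop x k

theorem φ_eq_foldl (t : ℝ≥0) (x : State n) (ω : Sample n) :
    φ t x ω = (jumpList ω t).foldl (fun y s => hopState y (siteAt ω s)) x := rfl

theorem φ_zero (x : State n) (ω : Sample n) : φ 0 x ω = x := by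
  have : jumpList ω ((0 : ℝ≥0) : ℝ) = [] := jumpList_eq (by simp [List.sortedLT_iff_pairwise])
    fun s => by
      simp only [List.not_mem_nil, false_iff]
      rintro ⟨h0, h1, -⟩
      rw [NNReal.coe_zero] at h1
      linarith
  rw [φ_eq_foldl, this]
  rfl

theorem φ_add (s t : ℝ≥0) (x : State n) (ω : Sample n) :
    φ (s + t) x ω = φ s (φ t x ω) (θ t ω) := by
  simp only [φ_eq_foldl]
  rw [NNReal.coe_add, jumpList_add, List.foldl_append, List.foldl_map]
  simp only [siteAt_θ]

/-- The jumps in `[0, t)` are those listed in `L`, in this order. -/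
def ListsJumps (ω : Sample n) (t : ℝ) (L : List (Fin (n + 1) × ℤ)) : Prop :=
  (L.Pairwise fun p q => jumpTime (ω.1 p.1) p.2 < jumpTime (ω.1 q.1) q.2) ∧
    (∀ p ∈ L, 0 ≤ jumpTime (ω.1 p.1) p.2 ∧ jumpTime (ω.1 p.1) p.2 < t) ∧
    ∀ p : Fin (n + 1) × ℤ, 0 ≤ jumpTime (ω.1 p.1) p.2 → jumpTime (ω.1 p.1) p.2 < t → p ∈ L

theorem ListsJumps.jumpList {ω : Sample n} {t : ℝ} {L : List (Fin (n + 1) × ℤ)}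
    (h : ListsJumps ω t L) :
    TASEP.jumpList ω t = L.map fun p => jumpTime (ω.1 p.1) p.2 := by
  refine jumpList_eq (List.sortedLT_iff_pairwise.2 (List.pairwise_map.2 h.1)) fun s => ?_
  rw [List.mem_map]
  constructor
  · rintro ⟨p, hp, rfl⟩
    exact ⟨(h.2.1 p hp).1, (h.2.1 p hp).2, p.1, p.2, rfl⟩
  · rintro ⟨h0, h1, k, j, rfl⟩
    exact ⟨(k, j), h.2.2 (k, j) h0 h1, rfl⟩

/-- The state depends only on the order of the labels, so on the event that `L` lists the jumps the
cocycle is a fixed function of `x`. There are countably many `L`, which is how `φ` becomes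
measurable. -/
theorem ListsJumps.φ_eq {ω : Sample n} {t : ℝ≥0} {L : List (Fin (n + 1) × ℤ)}
    (h : ListsJumps ω t L) (x : State n) :
    φ t x ω = (L.map Prod.fst).foldl hopState x := by
  rw [φ_eq_foldl, h.jumpList, List.foldl_map, List.foldl_map]
  simp only [siteAt_jumpTime]

theorem exists_listsJumps (ω : Sample n) (t : ℝ) : ∃ L, ListsJumps ω t L := by
  have h : ∀ s ∈ jumpList ω t, ∃ p : Fin (n + 1) × ℤ, jumpTime (ω.1 p.1) p.2 = s := fun s hs => by
    obtain ⟨-, -, k, j, hj⟩ := mem_jumpList.1 hs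
    exact ⟨(k, j), hj⟩
  choose! f hf using h
  have hmap : ((jumpList ω t).map f).map (fun p => jumpTime (ω.1 p.1) p.2) = jumpList ω t := by
    rw [List.map_map]
    exact (List.map_congr_left fun s hs => hf s hs).trans (List.map_id _)
  refine ⟨(jumpList ω t).map f, ?_, ?_, ?_⟩
  · rw [← List.pairwise_map (f := fun p : Fin (n + 1) × ℤ => jumpTime (ω.1 p.1) p.2), hmap]
    exact List.sortedLT_iff_pairwise.1 (Finset.sortedLT_sort _)
  · intro p hp
    have : jumpTime (ω.1 p.1) p.2 ∈ jumpList ω t := by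
      rw [← hmap]
      exact List.mem_map.2 ⟨p, hp, rfl⟩
    have := mem_jumpList.1 this
    exact ⟨this.1, this.2.1⟩
  · intro p h0 h1
    have h2 : jumpTime (ω.1 p.1) p.2 ∈ jumpList ω t := mem_jumpList.2 ⟨h0, h1, p.1, p.2, rfl⟩
    refine List.mem_map.2 ⟨_, h2, ?_⟩
    have h3 := hf _ h2
    have h4 : (f (jumpTime (ω.1 p.1) p.2)).1 = p.1 := by
      by_contra hne
      exact ω.2.distinct _ _ hne _ _ h3
    refine Prod.ext h4 ?_
    rw [h4] at h3
    exact (ω.2.clock p.1).strictMono.injective h3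

/-! ### Measurability -/

@[fun_prop]
theorem measurable_jumpTime (l : ℤ) : Measurable fun ξ : ℤ → ℝ => jumpTime ξ l := by
  cases l <;> simp only [jumpTime] <;> fun_prop

theorem measurable_jumpTime_prod : Measurable fun p : (ℤ → ℝ) × ℤ => jumpTime p.1 p.2 :=
  measurable_from_prod_countable_left measurable_jumpTime

theorem measurable_gaps : Measurable gaps := by
  refine measurable_pi_iff.2 fun l => ?_
  match l with
  | Int.ofNat 0 => exact measurable_pi_apply _
  | Int.ofNat (l + 1) => exact (measurable_pi_apply _).sub (measurable_pi_apply _)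
  | Int.negSucc 0 => exact (measurable_pi_apply _).neg
  | Int.negSucc (l + 1) => exact (measurable_pi_apply _).sub (measurable_pi_apply _)

theorem measurableSet_isClock : MeasurableSet {ξ : ℤ → ℝ | IsClock ξ} := by
  have h : {ξ : ℤ → ℝ | IsClock ξ} = {ξ | 0 ≤ ξ 0} ∩ (⋂ i : ℤ, ⋂ (_ : i ≠ 0), {ξ | 0 < ξ i}) ∩
      {ξ | Tendsto (fun m : ℕ => ∑ i ∈ Finset.range m, ξ (i : ℤ)) atTop atTop} ∩
      {ξ | Tendsto (fun m : ℕ => ∑ i ∈ Finset.range m, ξ (-((i : ℤ) + 1))) atTop atTop} := by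
    ext ξ
    simp only [Set.mem_inter_iff, Set.mem_iInter, Set.mem_ofPred_eq]
    exact ⟨fun h => ⟨⟨⟨h.1, h.2⟩, h.3⟩, h.4⟩, fun h => ⟨h.1.1.1, h.1.1.2, h.1.2, h.2⟩⟩
  rw [h]
  refine (((measurableSet_le measurable_const (measurable_pi_apply _)).inter
    (MeasurableSet.iInter fun i => MeasurableSet.iInter fun _ =>
      measurableSet_lt measurable_const (measurable_pi_apply _))).inter ?_).inter ?_
  · exact measurableSet_tendsto atTop fun m => by fun_prop
  · exact measurableSet_tendsto atTop fun m => by fun_prop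

/-- On clocks, `firstIndex ≤ l` is a comparison with a single jump time. Off clocks the infimum may
be a default value, hence the subtype. -/
theorem measurable_firstIndex :
    Measurable fun p : ℝ × {ξ : ℤ → ℝ // IsClock ξ} => firstIndex p.2.1 p.1 := by
  refine measurable_of_Iic fun l => ?_
  have : (fun p : ℝ × {ξ : ℤ → ℝ // IsClock ξ} => firstIndex p.2.1 p.1) ⁻¹' Set.Iic l =
      {p | p.1 ≤ jumpTime p.2.1 l} := Set.ext fun p => p.2.2.firstIndex_le_iff p.1 l
  rw [this]
  exact measurableSet_le measurable_fst (by fun_prop)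

theorem measurable_shiftClock :
    Measurable fun p : ℝ × {ξ : ℤ → ℝ // IsClock ξ} => shiftClock p.1 p.2.1 := by
  refine measurable_gaps.comp (measurable_pi_iff.2 fun l => Measurable.sub ?_ measurable_fst)
  exact measurable_jumpTime_prod.comp
    ((measurable_subtype_coe.comp measurable_snd).prodMk (measurable_firstIndex.const_add l))

theorem measurableSet_isAdmissible :
    MeasurableSet {ω : Fin (n + 1) → ℤ → ℝ | IsAdmissible ω} := by
  have h : {ω : Fin (n + 1) → ℤ → ℝ | IsAdmissible ω} = (⋂ k, {ω | IsClock (ω k)}) ∩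
      ⋂ k, ⋂ k', ⋂ (_ : k ≠ k'), ⋂ j, ⋂ j', {ω | jumpTime (ω k) j ≠ jumpTime (ω k') j'} := by
    ext ω
    simp only [Set.mem_inter_iff, Set.mem_iInter, Set.mem_ofPred_eq]
    exact ⟨fun h => ⟨h.1, h.2⟩, fun h => ⟨h.1, h.2⟩⟩
  rw [h]
  refine (MeasurableSet.iInter fun k => measurable_pi_apply k measurableSet_isClock).inter
    (MeasurableSet.iInter fun k => MeasurableSet.iInter fun k' => MeasurableSet.iInter fun _ =>
      MeasurableSet.iInter fun j => MeasurableSet.iInter fun j' => ?_)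
  refine (measurableSet_eq_fun ?_ ?_).compl <;> fun_prop

theorem measurableEmbedding_sample :
    MeasurableEmbedding (Subtype.val : Sample n → Fin (n + 1) → ℤ → ℝ) :=
  MeasurableEmbedding.subtype_coe measurableSet_isAdmissible

theorem measurable_clock (k : Fin (n + 1)) : Measurable fun ω : Sample n => ω.1 k :=
  (measurable_pi_apply k).comp measurable_subtype_coe

theorem measurable_θ : Measurable fun p : ℝ × Sample n => θ p.1 p.2 := by
  refine Measurable.subtype_mk (measurable_pi_iff.2 fun k => ?_)
  have h : Measurable fun p : ℝ × Sample n =>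
      (p.1, (⟨p.2.1 k, p.2.2.clock k⟩ : {ξ : ℤ → ℝ // IsClock ξ})) :=
    measurable_fst.prodMk (((measurable_clock k).comp measurable_snd).subtype_mk)
  exact measurable_shiftClock.comp h

theorem measurableSet_listsJumps (L : List (Fin (n + 1) × ℤ)) :
    MeasurableSet {p : ℝ≥0 × Sample n | ListsJumps p.2 p.1 L} := by
  have hT : ∀ q : Fin (n + 1) × ℤ,
      Measurable fun p : ℝ≥0 × Sample n => jumpTime (p.2.1 q.1) q.2 := fun q =>
    (measurable_jumpTime q.2).comp ((measurable_clock q.1).comp measurable_snd)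
  have ht : Measurable fun p : ℝ≥0 × Sample n => (p.1 : ℝ) :=
    measurable_coe_nnreal_real.comp measurable_fst
  have h0 : ∀ q : Fin (n + 1) × ℤ,
      Measurable fun p : ℝ≥0 × Sample n => 0 ≤ jumpTime (p.2.1 q.1) q.2 := fun q =>
    measurableSet_setOfPred.1 (measurableSet_le measurable_const (hT q))
  have h1 : ∀ q : Fin (n + 1) × ℤ,
      Measurable fun p : ℝ≥0 × Sample n => jumpTime (p.2.1 q.1) q.2 < p.1 := fun q =>
    measurableSet_setOfPred.1 (measurableSet_lt (hT q) ht)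
  unfold ListsJumps
  simp only [List.pairwise_iff_get]
  refine measurableSet_setOfPred.2 (Measurable.and ?_ (Measurable.and ?_ ?_))
  · refine Measurable.forall fun i => Measurable.forall fun j => Measurable.imp measurable_const ?_
    exact measurableSet_setOfPred.1 (measurableSet_lt (hT _) (hT _))
  · exact Measurable.forall fun q => Measurable.imp measurable_const ((h0 q).and (h1 q))
  · exact Measurable.forall fun q => (h0 q).imp ((h1 q).imp measurable_const)

theorem measurable_φ :
    Measurable fun p : ℝ≥0 × State n × Sample n => φ p.1 p.2.1 p.2.2 := by
  refine measurable_to_countable' fun y => ?_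
  have h : (fun p : ℝ≥0 × State n × Sample n => φ p.1 p.2.1 p.2.2) ⁻¹' {y} =
      ⋃ L : List (Fin (n + 1) × ℤ),
        {p | (L.map Prod.fst).foldl hopState p.2.1 = y} ∩ {p | ListsJumps p.2.2 p.1 L} := by
    ext ⟨t, x, ω⟩
    simp only [Set.mem_preimage, Set.mem_singleton_iff, Set.mem_iUnion, Set.mem_inter_iff,
      Set.mem_ofPred_eq]
    constructor
    · intro hy
      obtain ⟨L, hL⟩ := exists_listsJumps ω t
      exact ⟨L, (hL.φ_eq x).symm.trans hy, hL⟩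
    · rintro ⟨L, hy, hL⟩
      exact (hL.φ_eq x).trans hy
  rw [h]
  refine MeasurableSet.iUnion fun L => MeasurableSet.inter ?_ ?_
  · exact (measurable_fst.comp measurable_snd)
      (show MeasurableSet {x : State n | (L.map Prod.fst).foldl hopState x = y} from trivial)
  · exact (measurable_fst.prodMk (measurable_snd.comp measurable_snd))
      (measurableSet_listsJumps L)

instance : DiscreteTopology (State n) :=
  DiscreteTopology.of_forall_le_dist (r := 1) one_pos fun x y hxy => by
    change 1 ≤ if x = y then (0 : ℝ) else 1
    rw [if_neg hxy]

instance : Nonempty (State n) := ⟨fun _ => false⟩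

theorem measurable_pullback (t : ℝ≥0) (x : State n) :
    Measurable fun ω : Sample n => φ t x (θ (-(t : ℝ)) ω) := by
  have h1 : Measurable fun ω : Sample n => ((-(t : ℝ), ω) : ℝ × Sample n) :=
    measurable_const.prodMk measurable_id
  have h2 : Measurable fun ω : Sample n => θ (-(t : ℝ)) ω := measurable_θ.comp h1
  have h3 : Measurable fun ω : Sample n =>
      ((t, x, θ (-(t : ℝ)) ω) : ℝ≥0 × State n × Sample n) :=
    measurable_const.prodMk (measurable_const.prodMk h2)
  have h4 := (measurable_φ (n := n)).comp h3
  rw [Function.comp_def] at h4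
  exact h4

theorem mem_pullbackLimit_iff {y : State n} {ω : Sample n} :
    y ∈ RDS.pullbackLimit θ φ ω ↔ ∀ m : ℕ, ∃ x, φ (m : ℝ≥0) x (θ (-(((m : ℝ≥0)) : ℝ)) ω) = y := by
  rw [RDS.pullbackLimit_eq_iInter_nat θ_add φ_add, Set.mem_iInter]
  rfl

theorem measurableSet_mem_pullbackLimit (y : State n) :
    MeasurableSet {ω : Sample n | y ∈ RDS.pullbackLimit θ φ ω} := by
  simp only [mem_pullbackLimit_iff]
  exact measurableSet_setOfPred.2 (Measurable.forall fun m => Measurable.exists fun x =>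
    measurableSet_setOfPred.1 (measurable_pullback (m : ℝ≥0) x
      (show MeasurableSet {y} from trivial)))

theorem measurableSet_graph_pullbackLimit :
    MeasurableSet {p : State n × Sample n | p.1 ∈ RDS.pullbackLimit θ φ p.2} := by
  have h : {p : State n × Sample n | p.1 ∈ RDS.pullbackLimit θ φ p.2} =
      ⋃ y : State n, {y} ×ˢ {ω : Sample n | y ∈ RDS.pullbackLimit θ φ ω} := by
    ext p
    rw [Set.mem_iUnion]
    constructor
    · exact fun hp => ⟨p.1, rfl, hp⟩
    · rintro ⟨y, rfl, hp⟩
      exact hp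
  rw [h]
  exact MeasurableSet.iUnion fun y =>
    MeasurableSet.prod trivial (measurableSet_mem_pullbackLimit y)

theorem isCompactRandomSet_pullbackLimit :
    RDS.IsCompactRandomSet (RDS.pullbackLimit (θ (n := n)) φ) where
  compact _ := (Set.toFinite _).isCompact
  measurable := measurableSet_graph_pullbackLimit

end TASEP

/-! ### The averaging identity for one exponential gap -/

namespace RenewalExp

theorem ae_pos_expMeasure (r : ℝ) : ∀ᵐ x ∂expMeasure r, 0 < x := by
  have hm : Measurable (gammaPDF 1 r) := (measurable_gammaPDFReal 1 r).ennreal_ofReal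
  rw [expMeasure, gammaMeasure, ae_withDensity_iff hm]
  -- The density need not vanish at `0`, so this point is discarded as a Lebesgue null set.
  have h0 : ∀ᵐ x : ℝ, x ≠ 0 := by
    simp [ae_iff]
  filter_upwards [h0] with x hx hpdf
  by_contra hneg
  exact hpdf (gammaPDF_of_neg (lt_of_le_of_ne (not_lt.1 hneg) hx))

theorem integral_expMeasure {r : ℝ} (hr : 0 < r) (f : ℝ → ℂ) :
    ∫ x, f x ∂expMeasure r = ∫ x in Set.Ioi 0, (r * Real.exp (-(r * x))) • f x := by
  have hm : Measurable (gammaPDF 1 r) := (measurable_gammaPDFReal 1 r).ennreal_ofReal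
  rw [expMeasure, gammaMeasure, integral_withDensity_eq_integral_toReal_smul hm
    (ae_of_all _ fun x => ENNReal.ofReal_lt_top), ← integral_Ici_eq_integral_Ioi,
    ← integral_indicator measurableSet_Ici]
  refine integral_congr_ae (ae_of_all _ fun x => ?_)
  by_cases hx : 0 ≤ x
  · have : (gammaPDF 1 r x).toReal = r * Real.exp (-(r * x)) := by
      rw [show gammaPDF 1 r x = exponentialPDF r x from rfl, exponentialPDF_of_nonneg hx,
        ENNReal.toReal_ofReal (by positivity)]
    simp only [this]
    rw [Set.indicator_of_mem (show x ∈ Set.Ici 0 from hx)]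
  · rw [Set.indicator_of_notMem (show x ∉ Set.Ici 0 from hx)]
    simp [gammaPDF_of_neg (not_le.1 hx)]

/-- The function `exp(-r ∫_t^∞ g)`. -/
noncomputable def expTail (r : ℝ) (g : ℝ → ℂ) (t : ℝ) : ℂ :=
  Complex.exp (-(r * ∫ v in Set.Ioi t, g v))

variable {r : ℝ} {g : ℝ → ℂ}

theorem integral_Ioi_eq (hg : Integrable g) (t : ℝ) :
    ∫ v in Set.Ioi t, g v = (∫ v in Set.Ioi 0, g v) - ∫ v in (0 : ℝ)..t, g v := by
  rw [← intervalIntegral.integral_interval_add_Ioi (a := 0) hg.integrableOn (b := t)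
    hg.integrableOn]
  ring

theorem continuous_expTail (r : ℝ) (hg : Integrable g) : Continuous (expTail r g) := by
  have h1 := hg.continuous_primitive 0
  have h2 : Continuous fun t => ∫ v in Set.Ioi t, g v := by
    rw [funext (integral_Ioi_eq hg)]
    fun_prop
  unfold expTail
  fun_prop

theorem norm_expTail_le (hr : 0 ≤ r) (hg : Integrable g) (t : ℝ) :
    ‖expTail r g t‖ ≤ Real.exp (r * ∫ v, ‖g v‖) := by
  rw [expTail, Complex.norm_exp]
  refine Real.exp_le_exp.2 ((Complex.re_le_norm _).trans ?_)
  rw [norm_neg, norm_mul, Complex.norm_real, Real.norm_of_nonneg hr]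
  refine mul_le_mul_of_nonneg_left ((norm_integral_le_integral_norm _).trans ?_) hr
  exact setIntegral_le_integral hg.norm (ae_of_all _ fun v => norm_nonneg _)

theorem tendsto_expTail (r : ℝ) (hg : Integrable g) :
    Tendsto (expTail r g) atTop (𝓝 1) := by
  have h1 := intervalIntegral_tendsto_integral_Ioi 0 hg.integrableOn tendsto_id
  have h2 : Tendsto (fun t => ∫ v in Set.Ioi t, g v) atTop (𝓝 0) := by
    rw [funext (integral_Ioi_eq hg)]
    simpa using (tendsto_const_nhds (x := ∫ v in Set.Ioi 0, g v)).sub h1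
  have h3 : Tendsto (fun t => -((r : ℂ) * ∫ v in Set.Ioi t, g v)) atTop (𝓝 0) := by
    simpa using (h2.const_mul (r : ℂ)).neg
  rw [← Complex.exp_zero]
  exact (Complex.continuous_exp.tendsto 0).comp h3

theorem integrable_exp_mul_comp (hr : 0 < r) {f : ℝ → ℂ} (hf : Measurable f) {C : ℝ}
    (hC : ∀ x, ‖f x‖ ≤ C) :
    IntegrableOn (fun s => (r * Real.exp (-(r * s))) • f s) (Set.Ioi 0) := by
  have h1 : IntegrableOn (fun s : ℝ => r * Real.exp (-(r * s))) (Set.Ioi 0) := by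
    simp only [← neg_mul]
    exact (exp_neg_integrableOn_Ioi 0 hr).const_mul r
  exact h1.smul_bdd C hf.aestronglyMeasurable (ae_of_all _ hC)

/-- Since `G' = r g G` for `G = expTail r g`, the integrand times the density is the derivative of
`-exp(-r s) G(t + s)`, which runs from `-G(t)` to `0`. Probabilistically, this conditions on the
first jump after `t`. -/
theorem integral_expTail_of_continuous (hr : 0 < r) (hg : Integrable g) (hc : Continuous g)
    {C : ℝ} (hC : ∀ x, ‖g x‖ ≤ C) (t : ℝ) :
    ∫ s, (1 - g (t + s)) * expTail r g (t + s) ∂expMeasure r = expTail r g t := by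
  have hderiv : ∀ x, HasDerivAt (expTail r g) (r * g x * expTail r g x) x := fun x => by
    have h1 : HasDerivAt (fun t => ∫ v in (0 : ℝ)..t, g v) (g x) x :=
      intervalIntegral.integral_hasDerivAt_right hg.intervalIntegrable
        (hc.stronglyMeasurableAtFilter _ _) hc.continuousAt
    have h2 : HasDerivAt (fun t => ∫ v in Set.Ioi t, g v) (-g x) x := by
      rw [funext (integral_Ioi_eq hg)]
      exact h1.const_sub _
    have h3 := ((h2.const_mul (r : ℂ)).neg).cexp
    refine h3.congr_deriv ?_
    simp only [expTail, Pi.neg_apply]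
    ring
  have hF : ∀ s, HasDerivAt (fun s : ℝ => -((Real.exp (-(r * s)) : ℂ) * expTail r g (t + s)))
      ((r * Real.exp (-(r * s))) • ((1 - g (t + s)) * expTail r g (t + s))) s := fun s => by
    have h1 : HasDerivAt (fun s : ℝ => Real.exp (-(r * s))) (Real.exp (-(r * s)) * (-r)) s := by
      have := ((hasDerivAt_id s).const_mul r).neg.exp
      simpa using this
    have h2 : HasDerivAt (fun s => expTail r g (t + s))
        (r * g (t + s) * expTail r g (t + s)) s := by
      have := HasDerivAt.comp_const_add t s (hderiv (t + s))
      exact this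
    refine ((h1.ofReal_comp.mul h2).neg).congr_deriv ?_
    simp only [Complex.real_smul]
    push_cast
    ring
  rw [integral_expMeasure hr]
  have hcont := continuous_expTail r hg
  rw [integral_Ioi_of_hasDerivAt_of_tendsto (hF 0).continuousAt.continuousWithinAt
    (fun s _ => hF s) (m := 0)]
  · simp
  · refine integrable_exp_mul_comp hr (C := (1 + C) * Real.exp (r * ∫ v, ‖g v‖))
      (by fun_prop) fun s => ?_
    rw [norm_mul]
    have h1 : ‖1 - g (t + s)‖ ≤ 1 + C :=
      (norm_sub_le _ _).trans (by simpa using hC _)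
    exact mul_le_mul h1 (norm_expTail_le hr.le hg _) (norm_nonneg _)
      ((norm_nonneg _).trans h1)
  · rw [← neg_zero]
    refine Tendsto.neg ?_
    rw [← zero_mul (1 : ℂ)]
    refine Tendsto.mul ?_ ((tendsto_expTail r hg).comp
      (tendsto_atTop_add_const_left _ t tendsto_id))
    have : Tendsto (fun s : ℝ => Real.exp (-(r * s))) atTop (𝓝 0) :=
      Real.tendsto_exp_neg_atTop_nhds_zero.comp (tendsto_id.const_mul_atTop hr)
    exact (Complex.continuous_ofReal.tendsto 0).comp this

/-- Approximation in `L¹` by continuous functions of compact support removes the continuity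
assumption. -/
theorem integral_expTail (hr : 0 < r) (hg : Integrable g) (hm : Measurable g) {C : ℝ}
    (hC : ∀ x, ‖g x‖ ≤ C) (t : ℝ) :
    ∫ s, (1 - g (t + s)) * expTail r g (t + s) ∂expMeasure r = expTail r g t := by
  have hprob := isProbabilityMeasure_expMeasure hr
  choose f hfc hfd hfcont hfint using fun m : ℕ =>
    hg.exists_hasCompactSupport_integral_sub_le (ε := 1 / ((m : ℝ) + 1)) (by positivity)
  have hfb : ∀ m, ∃ K, ∀ x, ‖f m x‖ ≤ K := fun m =>
    (hfcont m).bounded_above_of_compact_support (hfc m)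
  have hlim0 : Tendsto (fun m => ∫ x, ‖g x - f m x‖) atTop (𝓝 0) :=
    squeeze_zero (fun m => integral_nonneg fun x => norm_nonneg _) hfd
      tendsto_one_div_add_atTop_nhds_zero_nat
  have hG : ∀ x, Tendsto (fun m => expTail r (f m) x) atTop (𝓝 (expTail r g x)) := fun x => by
    have h1 : Tendsto (fun m => ∫ v in Set.Ioi x, f m v) atTop (𝓝 (∫ v in Set.Ioi x, g v)) := by
      rw [tendsto_iff_norm_sub_tendsto_zero]
      refine squeeze_zero (fun _ => norm_nonneg _) (fun m => ?_) hlim0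
      rw [norm_sub_rev, ← integral_sub hg.integrableOn (hfint m).integrableOn]
      exact (norm_integral_le_integral_norm _).trans (setIntegral_le_integral
        (hg.sub (hfint m)).norm (ae_of_all _ fun v => norm_nonneg _))
    exact (Complex.continuous_exp.tendsto _).comp ((h1.const_mul (r : ℂ)).neg)
  -- A bound uniform in `m`, because `‖f m‖₁ ≤ ‖g‖₁ + 1`.
  set M : ℝ := Real.exp (r * ((∫ v, ‖g v‖) + 1)) with hMdef
  have hM : ∀ m x, ‖expTail r (f m) x‖ ≤ M := fun m x => by
    refine (norm_expTail_le hr.le (hfint m) x).trans (Real.exp_le_exp.2 ?_)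
    refine mul_le_mul_of_nonneg_left ?_ hr.le
    have h1 : ∫ v, ‖f m v‖ ≤ ∫ v, (‖g v‖ + ‖g v - f m v‖) := by
      refine integral_mono (hfint m).norm (hg.norm.add (hg.sub (hfint m)).norm) fun v => ?_
      have := norm_sub_le (g v) (g v - f m v)
      simpa using this
    have h3 := integral_add hg.norm (hg.sub (hfint m)).norm
    simp only [Pi.sub_apply] at h3
    rw [h3] at h1
    have h2 : 1 / ((m : ℝ) + 1) ≤ 1 := by
      rw [div_le_one (by positivity)]
      linarith [(Nat.cast_nonneg m : (0 : ℝ) ≤ m)]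
    linarith [hfd m]
  have hGmeas := fun m => (continuous_expTail r (hfint m)).measurable
  have hfmeas := fun m => (hfcont m).measurable
  -- The `f m` have no common sup bound. The factor `1 - g` is therefore kept in the main term,
  -- which is then dominated, and `g - f m` is put in a remainder controlled in `L¹`, the
  -- exponential density being at most `r`.
  have key : ∀ m, expTail r (f m) t =
      ∫ s, (1 - g (t + s)) * expTail r (f m) (t + s) ∂expMeasure r +
      ∫ s, (g (t + s) - f m (t + s)) * expTail r (f m) (t + s) ∂expMeasure r := fun m => by
    obtain ⟨K, hK⟩ := hfb m
    rw [← integral_expTail_of_continuous hr (hfint m) (hfcont m) hK t, ← integral_add]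
    · congr 1
      funext s
      ring
    · refine Integrable.of_bound (Measurable.aestronglyMeasurable (by fun_prop))
        ((1 + C) * M) (ae_of_all _ fun s => ?_)
      rw [norm_mul]
      have h1 : ‖1 - g (t + s)‖ ≤ 1 + C := (norm_sub_le _ _).trans (by simpa using hC _)
      exact mul_le_mul h1 (hM _ _) (norm_nonneg _) ((norm_nonneg _).trans h1)
    · refine Integrable.of_bound (Measurable.aestronglyMeasurable (by fun_prop))
        ((C + K) * M) (ae_of_all _ fun s => ?_)
      rw [norm_mul]
      have h1 : ‖g (t + s) - f m (t + s)‖ ≤ C + K :=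
        (norm_sub_le _ _).trans (add_le_add (hC _) (hK _))
      exact mul_le_mul h1 (hM _ _) (norm_nonneg _) ((norm_nonneg _).trans h1)
  have lim1 : Tendsto (fun m => ∫ s, (1 - g (t + s)) * expTail r (f m) (t + s) ∂expMeasure r)
      atTop (𝓝 (∫ s, (1 - g (t + s)) * expTail r g (t + s) ∂expMeasure r)) := by
    refine tendsto_integral_of_dominated_convergence (fun _ => (1 + C) * M)
      (fun m => Measurable.aestronglyMeasurable (by fun_prop)) (integrable_const _)
      (fun m => ae_of_all _ fun s => ?_)
      (ae_of_all _ fun s => (hG _).const_mul _)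
    rw [norm_mul]
    have h1 : ‖1 - g (t + s)‖ ≤ 1 + C := (norm_sub_le _ _).trans (by simpa using hC _)
    exact mul_le_mul h1 (hM _ _) (norm_nonneg _) ((norm_nonneg _).trans h1)
  have lim2 : Tendsto
      (fun m => ∫ s, (g (t + s) - f m (t + s)) * expTail r (f m) (t + s) ∂expMeasure r)
      atTop (𝓝 0) := by
    have hlim : Tendsto (fun m => r * M * ∫ x, ‖g x - f m x‖) atTop (𝓝 0) := by
      simpa using hlim0.const_mul (r * M)
    refine squeeze_zero_norm (fun m => ?_) hlim
    rw [integral_expMeasure hr, ← integral_const_mul]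
    have hi : Integrable fun s => r * M * ‖g (t + s) - f m (t + s)‖ :=
      ((hg.sub (hfint m)).norm.comp_add_left t).const_mul _
    refine (norm_integral_le_integral_norm _).trans ?_
    calc ∫ s in Set.Ioi 0,
          ‖(r * Real.exp (-(r * s))) • ((g (t + s) - f m (t + s)) * expTail r (f m) (t + s))‖
        ≤ ∫ s in Set.Ioi 0, r * M * ‖g (t + s) - f m (t + s)‖ := by
          refine integral_mono_of_nonneg (ae_of_all _ fun s => norm_nonneg _) hi.integrableOn ?_
          refine (ae_restrict_mem measurableSet_Ioi).mono fun s hs => ?_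
          have hs' : (0 : ℝ) < s := hs
          simp only
          rw [norm_smul, norm_mul (g (t + s) - f m (t + s)), Real.norm_of_nonneg (by positivity)]
          have h1 : Real.exp (-(r * s)) ≤ 1 := Real.exp_le_one_iff.2 (by nlinarith)
          have h2 : r * Real.exp (-(r * s)) ≤ r := by nlinarith
          calc r * Real.exp (-(r * s)) * (‖g (t + s) - f m (t + s)‖ * ‖expTail r (f m) (t + s)‖)
              ≤ r * (‖g (t + s) - f m (t + s)‖ * M) := by
                gcongr
                exact hM _ _
            _ = r * M * ‖g (t + s) - f m (t + s)‖ := by ring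
      _ ≤ ∫ s, r * M * ‖g (t + s) - f m (t + s)‖ :=
          setIntegral_le_integral hi (ae_of_all _ fun s => by positivity)
      _ = ∫ s, r * M * ‖g s - f m s‖ :=
          integral_add_left_eq_self (fun s => r * M * ‖g s - f m s‖) t
  have := tendsto_nhds_unique (hG t) ((lim1.add lim2).congr fun m => (key m).symm)
  rw [this, add_zero]

/-! ### Products over the renewal times of independent gaps -/

variable {Ω : Type*} [MeasurableSpace Ω] {P : Measure Ω}

theorem indepFun_of_dependsOn {ι β γ : Type*} [MeasurableSpace β] [MeasurableSpace γ]
    {X : ι → Ω → ℝ} (hX : iIndepFun X P) (hm : ∀ i, Measurable (X i)) {S T : Finset ι}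
    (hST : Disjoint S T) {Ψ : (ι → ℝ) → β} {Φ : (ι → ℝ) → γ} (hΨ : Measurable Ψ)
    (hΦ : Measurable Φ) (dΨ : DependsOn Ψ S) (dΦ : DependsOn Φ T) :
    IndepFun (fun ω => Ψ fun i => X i ω) (fun ω => Φ fun i => X i ω) P := by
  classical
  -- Extension by zero outside `U`; by `DependsOn` the values put there are irrelevant, so `Ψ` and
  -- `Φ` factor through finite restrictions.
  set e : (U : Finset ι) → (U → ℝ) → ι → ℝ := fun U v i => if h : i ∈ U then v ⟨i, h⟩ else 0 with he
  have hem : ∀ U, Measurable (e U) := fun U => measurable_pi_iff.2 fun i => by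
    by_cases h : i ∈ U
    · simpa only [he, h, dif_pos] using measurable_pi_apply _
    · simpa only [he, h, dif_neg, not_false_eq_true] using measurable_const
  have key := (hX.indepFun_finset S T hST hm).comp (hΨ.comp (hem S)) (hΦ.comp (hem T))
  have h1 : (fun ω => Ψ fun i => X i ω) = (Ψ ∘ e S) ∘ fun ω (i : S) => X i ω := by
    funext ω
    refine dΨ fun i hi => ?_
    have hi' : i ∈ S := hi
    simp [he, hi']
  have h2 : (fun ω => Φ fun i => X i ω) = (Φ ∘ e T) ∘ fun ω (i : T) => X i ω := by
    funext ω
    refine dΦ fun i hi => ?_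
    have hi' : i ∈ T := hi
    simp [he, hi']
  rw [h1, h2]
  exact key

/-- Independence makes the joint law a product, so this is Fubini; it replaces conditioning on `Z`.
-/
theorem integral_of_indepFun {β γ : Type*} [MeasurableSpace β] [MeasurableSpace γ]
    [IsProbabilityMeasure P] {Z : Ω → β} {Y : Ω → γ} (hZY : IndepFun Z Y P) (hZ : Measurable Z)
    (hY : Measurable Y) {h : β × γ → ℂ} (hh : Measurable h)
    (hi : Integrable (fun ω => h (Z ω, Y ω)) P) :
    ∫ ω, h (Z ω, Y ω) ∂P = ∫ ω, ∫ y, h (Z ω, y) ∂(P.map Y) ∂P := by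
  have := Measure.isProbabilityMeasure_map (μ := P) hZ.aemeasurable
  have := Measure.isProbabilityMeasure_map (μ := P) hY.aemeasurable
  have h1 := (indepFun_iff_map_prod_eq_prod_map_map hZ.aemeasurable hY.aemeasurable).1 hZY
  have hZYm : Measurable fun ω => (Z ω, Y ω) := hZ.prodMk hY
  have h2 : Integrable h ((P.map Z).prod (P.map Y)) := by
    rw [← h1, integrable_map_measure hh.aestronglyMeasurable hZYm.aemeasurable]
    exact hi
  rw [← integral_map hZYm.aemeasurable hh.aestronglyMeasurable, h1, integral_prod _ h2,
    integral_map hZ.aemeasurable]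
  exact (hh.stronglyMeasurable.integral_prod_right').aestronglyMeasurable

/-- The product `∏ u(T_l)` over the first `m` renewal times of the gap sequence `x`. -/
noncomputable def renewalProd (u : ℝ → ℂ) (m : ℕ) (x : ℕ → ℝ) : ℂ :=
  ∏ l ∈ Finset.range m, u (∑ i ∈ Finset.range (l + 1), x i)

theorem measurable_renewalProd {u : ℝ → ℂ} (hu : Measurable u) (m : ℕ) :
    Measurable (renewalProd u m) := by
  unfold renewalProd
  fun_prop

theorem norm_renewalProd_le {u : ℝ → ℂ} (hu : ∀ x, ‖u x‖ ≤ 1) (m : ℕ) (x : ℕ → ℝ) :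
    ‖renewalProd u m x‖ ≤ 1 := by
  rw [renewalProd, norm_prod]
  exact Finset.prod_le_one (fun _ _ => norm_nonneg _) fun _ _ => hu _

theorem dependsOn_renewalProd (u : ℝ → ℂ) (m : ℕ) :
    DependsOn (renewalProd u m) (Finset.range m : Set ℕ) := fun x y hxy => by
  refine Finset.prod_congr rfl fun l hl => congrArg u (Finset.sum_congr rfl fun i hi => hxy i ?_)
  simp only [Finset.mem_range, Finset.coe_range, Set.mem_Iio] at *
  omega

variable {X : ℕ → Ω → ℝ}

/-- The martingale step: with the first `m` gaps frozen, averaging over the gap of index `m` by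
`integral_expTail` turns stage `m + 1` into stage `m`. -/
theorem integral_renewalProd_mul_expTail [IsProbabilityMeasure P] (hr : 0 < r)
    (hX : iIndepFun X P) (hXm : ∀ i, Measurable (X i)) (hXl : ∀ i, P.map (X i) = expMeasure r)
    (hg : Integrable g) (hgm : Measurable g) (hg1 : ∀ x, ‖1 - g x‖ ≤ 1) (m : ℕ) :
    ∫ ω, renewalProd (fun x => 1 - g x) m (fun i => X i ω) *
      expTail r g (∑ i ∈ Finset.range m, X i ω) ∂P = expTail r g 0 := by
  have hG := (continuous_expTail r hg).measurable
  have hu : Measurable fun x => 1 - g x := by fun_prop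
  have hgb : ∀ x, ‖g x‖ ≤ 2 := fun x => by
    have := norm_sub_le 1 (1 - g x)
    simp only [sub_sub_cancel, norm_one] at this
    linarith [hg1 x]
  induction m with
  | zero => simp [renewalProd]
  | succ m ih =>
    rw [← ih]
    set Ψ : (ℕ → ℝ) → ℂ × ℝ := fun x =>
      (renewalProd (fun x => 1 - g x) m x, ∑ i ∈ Finset.range m, x i) with hΨ
    have hΨm : Measurable Ψ := (measurable_renewalProd hu m).prodMk (by fun_prop)
    have hΨd : DependsOn Ψ (Finset.range m : Set ℕ) := fun x y hxy =>
      Prod.ext (dependsOn_renewalProd (fun x => 1 - g x) m hxy)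
        (Finset.sum_congr rfl fun i hi => hxy i hi)
    have hind : IndepFun (fun ω => Ψ fun i => X i ω) (X m) P :=
      indepFun_of_dependsOn hX hXm (S := Finset.range m) (T := {m})
        (Φ := fun x => x m) (by simp) hΨm (measurable_pi_apply m) hΨd
        (fun x y hxy => hxy m (by simp))
    set h : (ℂ × ℝ) × ℝ → ℂ := fun q =>
      q.1.1 * ((1 - g (q.1.2 + q.2)) * expTail r g (q.1.2 + q.2)) with hh
    have hhm : Measurable h := by fun_prop
    have hXprod : Measurable fun ω => (fun i => X i ω) := measurable_pi_iff.2 hXm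
    have h1 := integral_of_indepFun (h := h) hind (hΨm.comp hXprod) (hXm m) hhm ?_
    · have h2 : ∀ ω, renewalProd (fun x => 1 - g x) (m + 1) (fun i => X i ω) *
          expTail r g (∑ i ∈ Finset.range (m + 1), X i ω) = h (Ψ fun i => X i ω, X m ω) := by
        intro ω
        simp only [hh, hΨ, renewalProd]
        rw [Finset.prod_range_succ, Finset.sum_range_succ]
        ring
      simp_rw [h2]
      rw [h1]
      congr 1
      funext ω
      rw [hXl m]
      simp only [hh]
      rw [integral_const_mul, integral_expTail hr hg hgm hgb]
    · refine Integrable.of_bound (hhm.comp ((hΨm.comp hXprod).prodMk (hXm m))).aestronglyMeasurable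
        (1 * (1 * Real.exp (r * ∫ v, ‖g v‖))) (ae_of_all _ fun ω => ?_)
      simp only [hh, hΨ, norm_mul]
      gcongr
      · exact norm_renewalProd_le hg1 m _
      · exact hg1 _
      · exact norm_expTail_le hr.le hg _

/-- The gaps are truncated at `1`, so that the strong law applies without computing exponential
moments; the truncated mean is still positive. -/
theorem tendsto_sum_atTop [IsProbabilityMeasure P] (hX : iIndepFun X P)
    (hXm : ∀ i, Measurable (X i)) (hXl : ∀ i, P.map (X i) = expMeasure r) :
    ∀ᵐ ω ∂P, Tendsto (fun m => ∑ i ∈ Finset.range m, X i ω) atTop atTop := by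
  have hpos : ∀ i, ∀ᵐ ω ∂P, 0 < X i ω := fun i => by
    have := ae_pos_expMeasure r
    rw [← hXl i] at this
    exact ae_of_ae_map (hXm i).aemeasurable this
  set Y : ℕ → Ω → ℝ := fun i ω => min (X i ω) 1 with hY
  have hYm : ∀ i, Measurable (Y i) := fun i => (hXm i).min measurable_const
  have hYi : Integrable (Y 0) P := by
    refine Integrable.of_bound (hYm 0).aestronglyMeasurable 1 ?_
    filter_upwards [hpos 0] with ω hω
    rw [Real.norm_of_nonneg (le_min hω.le zero_le_one)]
    exact min_le_right _ _
  have hlaw := strong_law_ae_real Y hYi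
    (fun i j hij => (hX.indepFun hij).comp (measurable_id.min measurable_const)
      (measurable_id.min measurable_const))
    (fun i => IdentDistrib.comp (u := fun x : ℝ => min x 1)
      ⟨(hXm i).aemeasurable, (hXm 0).aemeasurable, by rw [hXl, hXl]⟩
      (measurable_id.min measurable_const))
  have hmean : 0 < ∫ ω, Y 0 ω ∂P := by
    have h0 : ∀ᵐ ω ∂P, 0 < Y 0 ω := by
      filter_upwards [hpos 0] with ω hω
      exact lt_min hω one_pos
    rw [integral_pos_iff_support_of_nonneg_ae (h0.mono fun ω hω => hω.le) hYi]
    have : P (Function.support (Y 0)) = 1 :=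
      (prob_compl_eq_zero_iff (measurableSet_support (hYm 0))).1 (by
        refine measure_mono_null (fun ω hω => ?_) h0
        simp only [Function.mem_support, ne_eq, Set.mem_compl_iff, not_not] at hω
        simp [hω])
    rw [this]
    exact one_pos
  filter_upwards [hlaw, ae_all_iff.2 hpos] with ω hω hp
  have h1 : Tendsto (fun m : ℕ => (∑ i ∈ Finset.range m, Y i ω) / m * m) atTop atTop :=
    hω.pos_mul_atTop hmean tendsto_natCast_atTop_atTop
  refine tendsto_atTop_mono' _ ?_ h1
  filter_upwards [eventually_ne_atTop 0] with m hm
  rw [div_mul_cancel₀ _ (Nat.cast_ne_zero.2 hm)]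
  exact Finset.sum_le_sum fun i _ => min_le_left _ _

/-- The product differs from the martingale by a factor `1 - G(S_m)`, which tends to `0` because the
renewal times `S_m` tend to infinity and `G` tends to `1` there. -/
theorem tendsto_integral_renewalProd [IsProbabilityMeasure P] (hr : 0 < r)
    (hX : iIndepFun X P) (hXm : ∀ i, Measurable (X i)) (hXl : ∀ i, P.map (X i) = expMeasure r)
    (hg : Integrable g) (hgm : Measurable g) (hg1 : ∀ x, ‖1 - g x‖ ≤ 1) :
    Tendsto (fun m => ∫ ω, renewalProd (fun x => 1 - g x) m (fun i => X i ω) ∂P) atTop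
      (𝓝 (expTail r g 0)) := by
  have hG := (continuous_expTail r hg).measurable
  have hu : Measurable fun x => 1 - g x := by fun_prop
  have hXprod : Measurable fun ω => (fun i => X i ω) := measurable_pi_iff.2 hXm
  have hRm : ∀ m, Measurable fun ω => renewalProd (fun x => 1 - g x) m (fun i => X i ω) :=
    fun m => (measurable_renewalProd hu m).comp hXprod
  have hSm : ∀ m, Measurable fun ω => ∑ i ∈ Finset.range m, X i ω := fun m => by fun_prop
  set M := Real.exp (r * ∫ v, ‖g v‖)
  have hlim : Tendsto (fun m => ∫ ω, renewalProd (fun x => 1 - g x) m (fun i => X i ω) *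
      (1 - expTail r g (∑ i ∈ Finset.range m, X i ω)) ∂P) atTop (𝓝 (∫ _, (0 : ℂ) ∂P)) := by
    refine tendsto_integral_of_dominated_convergence (fun _ => 1 * (1 + M))
      (fun m => ((hRm m).mul (measurable_const.sub (hG.comp (hSm m)))).aestronglyMeasurable)
      (integrable_const _) (fun m => ae_of_all _ fun ω => ?_) ?_
    · rw [norm_mul]
      have h2 : ‖1 - expTail r g (∑ i ∈ Finset.range m, X i ω)‖ ≤ 1 + M :=
        (norm_sub_le _ _).trans (by simpa using norm_expTail_le hr.le hg _)
      gcongr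
      exact norm_renewalProd_le hg1 m _
    · filter_upwards [tendsto_sum_atTop hX hXm hXl] with ω hω
      have h1 : Tendsto (fun m => ‖1 - expTail r g (∑ i ∈ Finset.range m, X i ω)‖) atTop
          (𝓝 0) := by
        simpa using (((tendsto_expTail r hg).comp hω).const_sub 1).norm
      refine squeeze_zero_norm (fun m => ?_) h1
      rw [norm_mul]
      exact mul_le_of_le_one_left (norm_nonneg _) (norm_renewalProd_le hg1 m _)
  rw [integral_zero] at hlim
  have h3 := hlim.add_const (expTail r g 0)
  rw [zero_add] at h3
  refine h3.congr fun m => ?_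
  rw [← integral_renewalProd_mul_expTail hr hX hXm hXl hg hgm hg1 m, ← integral_add]
  · congr 1
    funext ω
    ring
  · refine Integrable.of_bound
      ((hRm m).mul (measurable_const.sub (hG.comp (hSm m)))).aestronglyMeasurable (1 * (1 + M))
      (ae_of_all _ fun ω => ?_)
    rw [norm_mul]
    have h2 : ‖1 - expTail r g (∑ i ∈ Finset.range m, X i ω)‖ ≤ 1 + M :=
      (norm_sub_le _ _).trans (by simpa using norm_expTail_le hr.le hg _)
    gcongr
    exact norm_renewalProd_le hg1 m _
  · refine Integrable.of_bound
      ((hRm m).mul (hG.comp (hSm m))).aestronglyMeasurable (1 * M) (ae_of_all _ fun ω => ?_)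
    rw [norm_mul]
    gcongr
    · exact norm_renewalProd_le hg1 m _
    · exact norm_expTail_le hr.le hg _

end RenewalExp

/-! ### The product formula for a two-sided clock -/

namespace TASEP

open RenewalExp

/-- The law of the gaps of a single clock. -/
noncomputable def clockLaw (r : ℝ) : Measure (ℤ → ℝ) := Measure.infinitePi fun _ => expMeasure r

variable {r : ℝ} {g : ℝ → ℂ}

theorem isProbabilityMeasure_clockLaw (hr : 0 < r) : IsProbabilityMeasure (clockLaw r) := by
  have := isProbabilityMeasure_expMeasure hr
  unfold clockLaw
  infer_instance

theorem iIndepFun_gaps (hr : 0 < r) :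
    iIndepFun (fun (i : ℤ) (ξ : ℤ → ℝ) => ξ i) (clockLaw r) := by
  have := isProbabilityMeasure_expMeasure hr
  exact iIndepFun_infinitePi (X := fun _ x => x) fun _ => measurable_id

theorem map_gap (hr : 0 < r) (i : ℤ) : (clockLaw r).map (fun ξ => ξ i) = expMeasure r := by
  have := isProbabilityMeasure_expMeasure hr
  exact Measure.infinitePi_map_eval _ i

theorem negSucc_cast_injective : Function.Injective fun l : ℕ => -((l : ℤ) + 1) := fun a b h => by
  simp only at h
  omega

theorem ae_isClock (hr : 0 < r) : ∀ᵐ ξ ∂clockLaw r, IsClock ξ := by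
  have := isProbabilityMeasure_clockLaw hr
  have hpos : ∀ i : ℤ, ∀ᵐ ξ ∂clockLaw r, 0 < ξ i := fun i => by
    have := ae_pos_expMeasure r
    rw [← map_gap hr i] at this
    exact ae_of_ae_map (measurable_pi_apply i).aemeasurable this
  have h1 := tendsto_sum_atTop ((iIndepFun_gaps hr).precomp Nat.cast_injective)
    (fun i => measurable_pi_apply _) (fun i => map_gap hr _)
  have h2 := tendsto_sum_atTop ((iIndepFun_gaps hr).precomp negSucc_cast_injective)
    (fun i => measurable_pi_apply _) (fun i => map_gap hr _)
  filter_upwards [ae_all_iff.2 hpos, h1, h2] with ξ h0 h1 h2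
  exact ⟨(h0 0).le, fun i _ => h0 i, h1, h2⟩

/-- The product `∏ u(T_l)` over the jump times with `-m ≤ l < m`. -/
noncomputable def jumpProd (u : ℝ → ℂ) (m : ℕ) (ξ : ℤ → ℝ) : ℂ :=
  (∏ l ∈ Finset.range m, u (jumpTime ξ (Int.ofNat l))) *
    ∏ l ∈ Finset.range m, u (jumpTime ξ (Int.negSucc l))

/-- Nonnegative and negative indices use disjoint sets of gaps, so the expectation factors.
Reflection turns the negative half into a renewal product for `g(-x)`, and the two half-line
integrals add up to the integral over the line. -/
theorem tendsto_integral_jumpProd (hr : 0 < r) (hg : Integrable g) (hgm : Measurable g)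
    (hg1 : ∀ x, ‖1 - g x‖ ≤ 1) :
    Tendsto (fun m => ∫ ξ, jumpProd (fun x => 1 - g x) m ξ ∂clockLaw r) atTop
      (𝓝 (Complex.exp (-(r * ∫ x, g x)))) := by
  have := isProbabilityMeasure_clockLaw hr
  have hu : Measurable fun x => 1 - g x := by fun_prop
  have hu' : Measurable fun x => 1 - g (-x) := by fun_prop
  have h1 := tendsto_integral_renewalProd hr ((iIndepFun_gaps hr).precomp Nat.cast_injective)
    (fun i => measurable_pi_apply _) (fun i => map_gap hr _) hg hgm hg1
  have h2 := tendsto_integral_renewalProd (g := fun x => g (-x)) hr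
    ((iIndepFun_gaps hr).precomp negSucc_cast_injective)
    (fun i => measurable_pi_apply _) (fun i => map_gap hr _) hg.comp_neg
    (hgm.comp measurable_neg) (fun x => hg1 (-x))
  have h3 : Complex.exp (-(r * ∫ x, g x)) = expTail r g 0 * expTail r (fun x => g (-x)) 0 := by
    rw [expTail, expTail, ← Complex.exp_add, integral_comp_neg_Ioi, neg_zero,
      ← intervalIntegral.integral_Iic_add_Ioi (b := 0) hg.integrableOn hg.integrableOn]
    congr 1
    ring
  rw [h3]
  refine (h1.mul h2).congr fun m => ?_
  have hΨ : Measurable fun ξ : ℤ → ℝ => renewalProd (fun x => 1 - g x) m (fun i => ξ (i : ℤ)) :=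
    (measurable_renewalProd hu m).comp (measurable_pi_iff.2 fun i => measurable_pi_apply _)
  have hΦ : Measurable fun ξ : ℤ → ℝ =>
      renewalProd (fun x => 1 - g (-x)) m (fun i => ξ (-((i : ℤ) + 1))) :=
    (measurable_renewalProd hu' m).comp (measurable_pi_iff.2 fun i => measurable_pi_apply _)
  have hind := indepFun_of_dependsOn (iIndepFun_gaps hr) (fun i => measurable_pi_apply i)
    (S := (Finset.range m).image fun l : ℕ => (l : ℤ))
    (T := (Finset.range m).image fun l : ℕ => -((l : ℤ) + 1)) ?_ hΨ hΦ ?_ ?_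
  · have := hind.integral_fun_comp_mul_comp (f := fun z : ℂ => z) (g := fun z : ℂ => z)
      hΨ.aemeasurable hΦ.aemeasurable measurable_id.aestronglyMeasurable
      measurable_id.aestronglyMeasurable
    exact this.symm
  · rw [Finset.disjoint_left]
    intro a ha hb
    obtain ⟨i, -, rfl⟩ := Finset.mem_image.1 ha
    obtain ⟨j, -, hj⟩ := Finset.mem_image.1 hb
    omega
  · exact fun x y hxy => dependsOn_renewalProd _ m fun i hi =>
      hxy _ (Finset.mem_coe.2 (Finset.mem_image_of_mem _ (Finset.mem_coe.1 hi)))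
  · exact fun x y hxy => dependsOn_renewalProd _ m fun i hi =>
      hxy _ (Finset.mem_coe.2 (Finset.mem_image_of_mem _ (Finset.mem_coe.1 hi)))

/-- The indices `-m ≤ l < m`. -/
noncomputable def centralIndices (m : ℕ) : Finset ℤ := Finset.Ico (-(m : ℤ)) m

theorem jumpProd_eq_prod (u : ℝ → ℂ) (m : ℕ) (ξ : ℤ → ℝ) :
    jumpProd u m ξ = ∏ l ∈ centralIndices m, u (jumpTime ξ l) := by
  induction m with
  | zero => simp [jumpProd, centralIndices]
  | succ m ih =>
    have h : centralIndices (m + 1) =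
        insert (Int.ofNat m) (insert (Int.negSucc m) (centralIndices m)) := by
      ext l
      simp only [centralIndices, Finset.mem_insert, Finset.mem_Ico, Int.ofNat_eq_natCast,
        Int.negSucc_eq]
      push_cast
      omega
    rw [h, Finset.prod_insert, Finset.prod_insert, ← ih, jumpProd, jumpProd,
      Finset.prod_range_succ, Finset.prod_range_succ]
    · ring
    · simp only [centralIndices, Finset.mem_Ico, Int.negSucc_eq]
      omega
    · simp only [centralIndices, Finset.mem_insert, Finset.mem_Ico, Int.ofNat_eq_natCast,
        Int.negSucc_eq]
      omega

theorem eventually_subset_centralIndices (F : Finset ℤ) :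
    ∀ᶠ m in atTop, F ⊆ centralIndices m := by
  filter_upwards [eventually_ge_atTop (F.sup Int.natAbs + 1)] with m hm l hl
  have := Finset.le_sup (f := Int.natAbs) hl
  simp only [centralIndices, Finset.mem_Ico]
  omega

/-! ### Finite and infinite counts -/

/-- The indices of the jump times in `A`. -/
def hits (A : Set ℝ) (ξ : ℤ → ℝ) : Set ℤ := {l | jumpTime ξ l ∈ A}

theorem hits_mono {A B : Set ℝ} (h : A ⊆ B) (ξ : ℤ → ℝ) : hits A ξ ⊆ hits B ξ := fun _ hl => h hl

theorem measurable_hits {A : Set ℝ} (hA : MeasurableSet A) : Measurable (hits A) := by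
  refine measurable_set_iff.2 fun l => ?_
  exact measurableSet_setOfPred.1 (measurable_jumpTime l hA)

theorem measurable_encard_hits {A : Set ℝ} (hA : MeasurableSet A) :
    Measurable fun ξ => (hits A ξ).encard :=
  measurable_encard.comp (measurable_hits hA)

theorem measurable_ncard_hits {A : Set ℝ} (hA : MeasurableSet A) :
    Measurable fun ξ => ((hits A ξ).ncard : ℝ) :=
  measurable_from_top.comp (measurable_ncard.comp (measurable_hits hA))

theorem IsClock.encard_hits {ξ : ℤ → ℝ} (h : IsClock ξ) (A : Set ℝ) :
    (hits A ξ).encard = (points ξ ∩ A).encard := by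
  rw [← h.strictMono.injective.encard_image (hits A ξ)]
  congr 1
  ext s
  constructor
  · rintro ⟨l, hl, rfl⟩
    exact ⟨⟨l, rfl⟩, hl⟩
  · rintro ⟨⟨l, rfl⟩, hl⟩
    exact ⟨l, hl, rfl⟩

open Classical in
theorem ncard_hits_inter_centralIndices (A : Set ℝ) (m : ℕ) (ξ : ℤ → ℝ) :
    (hits A ξ ∩ centralIndices m).ncard =
      ((centralIndices m).filter fun l => jumpTime ξ l ∈ A).card := by
  rw [← Set.ncard_coe_finset]
  congr 1
  ext l
  simp [hits, and_comm]

theorem sum_indicator_centralIndices (A : Set ℝ) (m : ℕ) (ξ : ℤ → ℝ) :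
    ∑ l ∈ centralIndices m, A.indicator (1 : ℝ → ℝ) (jumpTime ξ l) =
      (hits A ξ ∩ centralIndices m).ncard := by
  classical
  rw [ncard_hits_inter_centralIndices, Finset.card_filter]
  push_cast
  exact Finset.sum_congr rfl fun l _ => by simp [Set.indicator_apply]

theorem eventually_inter_centralIndices {S : Set ℤ} (hS : S.Finite) :
    ∀ᶠ m in atTop, S ∩ centralIndices m = S := by
  filter_upwards [eventually_subset_centralIndices hS.toFinset] with m hm
  exact Set.inter_eq_left.2 fun l hl => Finset.mem_coe.2 (hm (hS.mem_toFinset.2 hl))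

theorem tendsto_ncard_inter_centralIndices {S : Set ℤ} (hS : S.Infinite) :
    Tendsto (fun m => (S ∩ centralIndices m).ncard) atTop atTop := by
  refine tendsto_atTop.2 fun k => ?_
  obtain ⟨F, hF, hFk⟩ := hS.exists_subset_card_eq k
  filter_upwards [eventually_subset_centralIndices F] with m hm
  rw [← hFk, ← Set.ncard_coe_finset F]
  exact Set.ncard_le_ncard (Set.subset_inter hF (Finset.coe_subset.2 hm))
    ((Finset.finite_toSet _).subset Set.inter_subset_right)

open Classical in
/-- The function `z ^ N` of a possibly infinite cardinality `N`. -/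
noncomputable def powCard (z : ℝ) (S : Set ℤ) : ℝ := if S.Infinite then 0 else z ^ S.ncard

/-- For `z < 1` the value `0` on infinite sets is the limit of `z ^ N` as `N` grows. -/
theorem tendsto_pow_powCard {z : ℝ} (h0 : 0 ≤ z) (h1 : z < 1) (S : Set ℤ) :
    Tendsto (fun m => z ^ (S ∩ centralIndices m).ncard) atTop (𝓝 (powCard z S)) := by
  by_cases hS : S.Infinite
  · rw [powCard, if_pos hS]
    exact (tendsto_pow_atTop_nhds_zero_of_lt_one h0 h1).comp
      (tendsto_ncard_inter_centralIndices hS)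
  · rw [powCard, if_neg hS]
    refine tendsto_const_nhds.congr' ?_
    filter_upwards [eventually_inter_centralIndices (Set.not_infinite.1 hS)] with m hm
    rw [hm]

theorem powCard_nonneg {z : ℝ} (h0 : 0 ≤ z) (S : Set ℤ) : 0 ≤ powCard z S := by
  unfold powCard
  split_ifs <;> positivity

theorem powCard_le_one {z : ℝ} (h0 : 0 ≤ z) (h1 : z ≤ 1) (S : Set ℤ) : powCard z S ≤ 1 := by
  unfold powCard
  split_ifs
  · exact zero_le_one
  · exact pow_le_one₀ h0 h1

theorem powCard_antitone {z : ℝ} (h0 : 0 ≤ z) (h1 : z ≤ 1) {S T : Set ℤ} (h : S ⊆ T) :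
    powCard z T ≤ powCard z S := by
  by_cases hT : T.Infinite
  · rw [powCard, if_pos hT]
    exact powCard_nonneg h0 S
  · have hS : ¬ S.Infinite := fun hS => hT (hS.mono h)
    rw [powCard, if_neg hT, powCard, if_neg hS]
    exact pow_le_pow_of_le_one h0 h1 (Set.ncard_le_ncard h (Set.not_infinite.1 hT))

theorem aestronglyMeasurable_powCard {A : Set ℝ} (hA : MeasurableSet A) {z : ℝ} (h0 : 0 ≤ z)
    (h1 : z < 1) : AEStronglyMeasurable (fun ξ => powCard z (hits A ξ)) (clockLaw r) := by
  refine aestronglyMeasurable_of_tendsto_ae atTop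
    (f := fun m ξ => z ^ (hits A ξ ∩ centralIndices m).ncard) (fun m => ?_)
    (ae_of_all _ fun ξ => tendsto_pow_powCard h0 h1 _)
  refine Measurable.aestronglyMeasurable ((measurable_from_top (f := fun k : ℕ => z ^ k)).comp
    (measurable_ncard.comp (measurable_set_iff.2 fun l => ?_)))
  exact (measurable_set_iff.1 (measurable_hits hA) l).and measurable_const

-- The product formula with `1 - g` equal to `z` on `A` and to `1` elsewhere. Real `z < 1` is used
-- because it detects infinite counts, which `ncard` would report as `0`.
open Classical in
theorem integral_powCard (hr : 0 < r) {A : Set ℝ} (hA : MeasurableSet A) (hv : volume A ≠ ∞)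
    {z : ℝ} (h0 : 0 ≤ z) (h1 : z < 1) :
    ∫ ξ, powCard z (hits A ξ) ∂clockLaw r = Real.exp (-(r * ((1 - z) * volume.real A))) := by
  have := isProbabilityMeasure_clockLaw hr
  set g : ℝ → ℂ := A.indicator fun _ => ((1 - z : ℝ) : ℂ) with hg
  have hgi : Integrable g := (integrable_indicator_iff hA).2 (integrableOn_const hv)
  have hgm : Measurable g := measurable_const.indicator hA
  have hu' : ∀ x, 1 - g x = ((if x ∈ A then z else 1 : ℝ) : ℂ) := fun x => by
    by_cases hx : x ∈ A <;> simp [hg, hx]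
  have hg1 : ∀ x, ‖1 - g x‖ ≤ 1 := fun x => by
    rw [hu', Complex.norm_real]
    split_ifs
    · rw [Real.norm_of_nonneg h0]
      exact h1.le
    · simp
  have hprod : ∀ m ξ, jumpProd (fun x => 1 - g x) m ξ =
      ((z ^ (hits A ξ ∩ centralIndices m).ncard : ℝ) : ℂ) := fun m ξ => by
    rw [jumpProd_eq_prod]
    simp_rw [hu']
    rw [← Complex.ofReal_prod, Finset.prod_ite, Finset.prod_const, Finset.prod_const_one, mul_one,
      ncard_hits_inter_centralIndices]
  have hlim := tendsto_integral_jumpProd hr hgi hgm hg1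
  have hprod' : ∀ m, ∫ ξ, jumpProd (fun x => 1 - g x) m ξ ∂clockLaw r =
      ((∫ ξ, z ^ (hits A ξ ∩ centralIndices m).ncard ∂clockLaw r : ℝ) : ℂ) := fun m => by
    exact (integral_congr_ae (ae_of_all _ (hprod m))).trans integral_ofReal
  rw [funext hprod'] at hlim
  have hlim2 : Tendsto (fun m => ∫ ξ, z ^ (hits A ξ ∩ centralIndices m).ncard ∂clockLaw r) atTop
      (𝓝 (∫ ξ, powCard z (hits A ξ) ∂clockLaw r)) := by
    refine tendsto_integral_of_dominated_convergence (fun _ => 1) (fun m => ?_)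
      (integrable_const _) (fun m => ae_of_all _ fun ξ => ?_)
      (ae_of_all _ fun ξ => tendsto_pow_powCard h0 h1 _)
    · refine Measurable.aestronglyMeasurable ((measurable_from_top (f := fun k : ℕ => z ^ k)).comp
        (measurable_ncard.comp (measurable_set_iff.2 fun l => ?_)))
      exact (measurable_set_iff.1 (measurable_hits hA) l).and measurable_const
    · rw [Real.norm_of_nonneg (by positivity)]
      exact pow_le_one₀ h0 h1.le
  have h2 := tendsto_nhds_unique hlim ((Complex.continuous_ofReal.tendsto _).comp hlim2)
  have h3 : ∫ x, g x = (((1 - z) * volume.real A : ℝ) : ℂ) := by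
    rw [hg, integral_indicator_const _ hA, Complex.real_smul]
    push_cast
    ring
  rw [h3] at h2
  refine Complex.ofReal_injective (Eq.trans h2.symm ?_)
  push_cast
  rfl

/-- As `z` increases to `1` the generating function tends to `1`, while it never exceeds the
probability of a finite count. -/
theorem ae_finite_hits (hr : 0 < r) {A : Set ℝ} (hA : MeasurableSet A) (hv : volume A ≠ ∞) :
    ∀ᵐ ξ ∂clockLaw r, (hits A ξ).Finite := by
  have := isProbabilityMeasure_clockLaw hr
  have hm : MeasurableSet {ξ | (hits A ξ).Finite} := by
    have : {ξ | (hits A ξ).Finite} = (fun ξ => (hits A ξ).encard) ⁻¹' {⊤}ᶜ := by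
      ext ξ
      simp
    rw [this]
    exact measurable_encard_hits hA trivial
  have hle : ∀ z : ℝ, 0 ≤ z → z < 1 →
      Real.exp (-(r * ((1 - z) * volume.real A))) ≤ (clockLaw r).real {ξ | (hits A ξ).Finite} :=
    fun z h0 h1 => by
      rw [← integral_powCard hr hA hv h0 h1, ← integral_indicator_one hm]
      refine integral_mono_of_nonneg (ae_of_all _ fun ξ => powCard_nonneg h0 _)
        ((integrable_const (1 : ℝ)).indicator hm) (ae_of_all _ fun ξ => ?_)
      by_cases hξ : (hits A ξ).Finite
      · simpa [hξ] using powCard_le_one h0 h1.le _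
      · have hinf : (hits A ξ).Infinite := hξ
        simp only [powCard, if_pos hinf]
        exact Set.indicator_nonneg (fun _ _ => zero_le_one) _
  have hlim : Tendsto (fun z : ℝ => Real.exp (-(r * ((1 - z) * volume.real A)))) (𝓝[<] 1)
      (𝓝 1) := by
    have : Continuous fun z : ℝ => Real.exp (-(r * ((1 - z) * volume.real A))) := by fun_prop
    simpa using (this.tendsto 1).mono_left nhdsWithin_le_nhds
  have h1 : 1 ≤ (clockLaw r).real {ξ | (hits A ξ).Finite} := by
    refine le_of_tendsto hlim ?_
    filter_upwards [Ioo_mem_nhdsLT (show (0 : ℝ) < 1 from one_pos)] with z hz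
    exact hle z hz.1.le hz.2
  have h2 : (clockLaw r).real {ξ | (hits A ξ).Finite} = 1 := le_antisymm measureReal_le_one h1
  exact (prob_compl_eq_zero_iff hm).2 ((ENNReal.toReal_eq_one_iff _).1 h2)

/-- The mean of `(1/2) ^ N` is at most `exp(-(r/2) |A ∩ [-m, m]|)` for every `m`, hence zero, so `N`
is almost surely infinite. -/
theorem ae_infinite_hits (hr : 0 < r) {A : Set ℝ} (hA : MeasurableSet A) (hv : volume A = ∞) :
    ∀ᵐ ξ ∂clockLaw r, (hits A ξ).Infinite := by
  have := isProbabilityMeasure_clockLaw hr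
  have hint : Integrable (fun ξ => powCard (1 / 2) (hits A ξ)) (clockLaw r) := by
    refine Integrable.of_bound (aestronglyMeasurable_powCard hA (by norm_num) (by norm_num)) 1
      (ae_of_all _ fun ξ => ?_)
    rw [Real.norm_of_nonneg (powCard_nonneg (by norm_num) _)]
    exact powCard_le_one (by norm_num) (by norm_num) _
  set I := ∫ ξ, powCard (1 / 2) (hits A ξ) ∂clockLaw r with hI
  have hle : ∀ m : ℕ, I ≤ Real.exp (-(r * ((1 - 1 / 2) *
      volume.real (A ∩ Set.Icc (-(m : ℝ)) m)))) := fun m => by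
    have hf : volume (A ∩ Set.Icc (-(m : ℝ)) m) ≠ ∞ :=
      ((measure_mono Set.inter_subset_right).trans_lt (by simp [Real.volume_Icc])).ne
    rw [← integral_powCard hr (hA.inter measurableSet_Icc) hf (by norm_num) (by norm_num)]
    exact integral_mono_of_nonneg (ae_of_all _ fun ξ => powCard_nonneg (by norm_num) _)
      (Integrable.of_bound (aestronglyMeasurable_powCard (hA.inter measurableSet_Icc)
        (by norm_num) (by norm_num)) 1 (ae_of_all _ fun ξ => by
          rw [Real.norm_of_nonneg (powCard_nonneg (by norm_num) _)]
          exact powCard_le_one (by norm_num) (by norm_num) _))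
      (ae_of_all _ fun ξ => powCard_antitone (by norm_num) (by norm_num)
        (hits_mono Set.inter_subset_left ξ))
  have hI0 : I = 0 := by
    by_contra hne
    have hpos : 0 < I := lt_of_le_of_ne
      (integral_nonneg fun ξ => powCard_nonneg (by norm_num) _) (Ne.symm hne)
    -- Taking logarithms in `hle`; the factor `2 / r` inverts `r (1 - 1/2)`.
    have hb : ∀ m : ℕ, volume (A ∩ Set.Icc (-(m : ℝ)) m) ≤
        ENNReal.ofReal (2 / r * -Real.log I) := fun m => by
      have hf : volume (A ∩ Set.Icc (-(m : ℝ)) m) ≠ ∞ :=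
        ((measure_mono Set.inter_subset_right).trans_lt (by simp [Real.volume_Icc])).ne
      rw [← ENNReal.ofReal_toReal hf]
      refine ENNReal.ofReal_le_ofReal ?_
      have h1 := (Real.log_le_iff_le_exp hpos).2 (hle m)
      change volume.real _ ≤ _
      rw [div_mul_eq_mul_div, le_div_iff₀ hr]
      linarith
    have h2 : volume A = ⨆ m : ℕ, volume (A ∩ Set.Icc (-(m : ℝ)) m) := by
      rw [← Monotone.measure_iUnion]
      · congr 1
        rw [← Set.inter_iUnion]
        refine (Set.inter_eq_left.2 fun x _ => ?_).symm
        obtain ⟨m, hm⟩ := exists_nat_ge |x|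
        exact Set.mem_iUnion.2 ⟨m, abs_le.1 hm⟩
      · intro m k hmk
        have : (m : ℝ) ≤ k := Nat.cast_le.2 hmk
        exact Set.inter_subset_inter_right _ (Set.Icc_subset_Icc (by linarith) this)
    have h3 := iSup_le hb
    rw [← h2, hv] at h3
    exact (ENNReal.ofReal_ne_top (top_le_iff.1 h3))
  have h0 := (integral_eq_zero_iff_of_nonneg
    (fun ξ => powCard_nonneg (by norm_num) (hits A ξ)) hint).1 hI0
  filter_upwards [h0] with ξ hξ
  by_contra hfin
  simp [powCard, hfin] at hξ

/-! ### Characteristic functions, Poisson laws and independence of counts -/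

theorem integrable_one_sub_cexp_indicator {ι : Type*} [Fintype ι] {A : ι → Set ℝ}
    (hA : ∀ j, MeasurableSet (A j)) (hv : ∀ j, volume (A j) ≠ ∞) (c : ι → ℝ) :
    Integrable fun x : ℝ => 1 - Complex.exp
      (((∑ j, (A j).indicator (1 : ℝ → ℝ) x * c j : ℝ) : ℂ) * Complex.I) := by
  have hm : Measurable fun x : ℝ => 1 - Complex.exp
      (((∑ j, (A j).indicator (1 : ℝ → ℝ) x * c j : ℝ) : ℂ) * Complex.I) := by
    have : ∀ j, Measurable ((A j).indicator (1 : ℝ → ℝ)) := fun j =>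
      measurable_one.indicator (hA j)
    fun_prop
  have hU : volume (⋃ j, A j) < ∞ :=
    (measure_iUnion_fintype_le _ _).trans_lt
      (ENNReal.sum_lt_top.2 fun j _ => (hv j).lt_top)
  have h1 := Measure.integrableOn_of_bounded (s := ⋃ j, A j) (M := 2) hU.ne
    hm.aestronglyMeasurable (ae_of_all _ fun x => ?_)
  · refine h1.integrable_of_forall_notMem_eq_zero fun x hx => ?_
    have : ∀ j, x ∉ A j := fun j hj => hx (Set.mem_iUnion.2 ⟨j, hj⟩)
    simp [this]
  · refine (norm_sub_le _ _).trans ?_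
    rw [Complex.norm_exp_ofReal_mul_I, norm_one]
    norm_num

/-- For `u = exp(i ∑ c_j 1_{A_j})` the product over jump times is eventually `exp(i ∑ c_j N(A_j))`,
since almost surely finitely many jumps lie in the `A_j`. As `u` is unimodular, dominated
convergence applies. -/
theorem integral_cexp_sum_ncard (hr : 0 < r) {ι : Type*} [Fintype ι] {A : ι → Set ℝ}
    (hA : ∀ j, MeasurableSet (A j)) (hv : ∀ j, volume (A j) ≠ ∞) (c : ι → ℝ) :
    ∫ ξ, Complex.exp (((∑ j, (hits (A j) ξ).ncard * c j : ℝ) : ℂ) * Complex.I) ∂clockLaw r =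
      Complex.exp (-(r * ∫ x, (1 - Complex.exp
        (((∑ j, (A j).indicator (1 : ℝ → ℝ) x * c j : ℝ) : ℂ) * Complex.I)))) := by
  have := isProbabilityMeasure_clockLaw hr
  have hind : ∀ j, Measurable ((A j).indicator (1 : ℝ → ℝ)) := fun j =>
    measurable_one.indicator (hA j)
  have hlim := tendsto_integral_jumpProd hr (integrable_one_sub_cexp_indicator hA hv c)
    (by fun_prop) (fun x => by
      rw [sub_sub_cancel, Complex.norm_exp_ofReal_mul_I])
  simp only [sub_sub_cancel] at hlim
  set u : ℝ → ℂ := fun x => Complex.exp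
    (((∑ j, (A j).indicator (1 : ℝ → ℝ) x * c j : ℝ) : ℂ) * Complex.I) with hu
  refine tendsto_nhds_unique (tendsto_integral_of_dominated_convergence
    (F := fun m ξ => jumpProd u m ξ) (fun _ => 1) (fun m => ?_)
    (integrable_const _) (fun m => ae_of_all _ fun ξ => ?_) ?_) hlim
  · simp only [jumpProd_eq_prod]
    refine Measurable.aestronglyMeasurable ?_
    fun_prop
  · rw [jumpProd_eq_prod, norm_prod]
    simp only [hu, Complex.norm_exp_ofReal_mul_I, Finset.prod_const_one, le_refl]
  · filter_upwards [ae_all_iff.2 fun j => ae_finite_hits hr (hA j) (hv j)] with ξ hξ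
    refine tendsto_const_nhds.congr' ?_
    filter_upwards [eventually_all.2 fun j => eventually_inter_centralIndices (hξ j)] with m hm
    rw [jumpProd_eq_prod, ← Complex.exp_sum, ← Finset.sum_mul, ← Complex.ofReal_sum,
      Finset.sum_comm]
    congr 3
    refine Finset.sum_congr rfl fun j _ => ?_
    rw [← Finset.sum_mul, sum_indicator_centralIndices, hm j]

theorem measurable_ncardVector {ι : Type*} [Fintype ι] {A : ι → Set ℝ}
    (hA : ∀ j, MeasurableSet (A j)) :
    Measurable fun ξ => WithLp.toLp 2 fun j => ((hits (A j) ξ).ncard : ℝ) :=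
  (WithLp.measurable_toLp 2 _).comp (measurable_pi_iff.2 fun j => measurable_ncard_hits (hA j))

theorem charFun_ncardVector (hr : 0 < r) {ι : Type*} [Fintype ι] {A : ι → Set ℝ}
    (hA : ∀ j, MeasurableSet (A j)) (hv : ∀ j, volume (A j) ≠ ∞) (c : EuclideanSpace ℝ ι) :
    charFun ((clockLaw r).map fun ξ => WithLp.toLp 2 fun j => ((hits (A j) ξ).ncard : ℝ)) c =
      Complex.exp (-(r * ∫ x, (1 - Complex.exp
        (((∑ j, (A j).indicator (1 : ℝ → ℝ) x * c j : ℝ) : ℂ) * Complex.I)))) := by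
  rw [← integral_cexp_sum_ncard hr hA hv, charFun_apply,
    integral_map (measurable_ncardVector hA).aemeasurable
      (Measurable.aestronglyMeasurable (by fun_prop))]
  congr 1
  funext ξ
  congr 3
  simp [PiLp.inner_apply, mul_comm]

theorem charFun_ncard (hr : 0 < r) {A : Set ℝ} (hA : MeasurableSet A) (hv : volume A ≠ ∞)
    (c : ℝ) : charFun ((clockLaw r).map fun ξ => ((hits A ξ).ncard : ℝ)) c =
      Complex.exp (-(r * (volume.real A * (1 - Complex.exp (c * Complex.I))))) := by
  have h := integral_cexp_sum_ncard hr (ι := Unit) (A := fun _ => A) (fun _ => hA) (fun _ => hv)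
    (fun _ => c)
  simp only [Finset.univ_unique, Finset.sum_const, Finset.card_singleton, one_smul] at h
  rw [charFun_apply, integral_map (measurable_ncard_hits hA).aemeasurable
    (Measurable.aestronglyMeasurable (by fun_prop))]
  have h1 : ∀ x : ℝ, inner ℝ x c = x * c := fun x => by simp [mul_comm]
  simp only [h1]
  rw [h]
  have h2 : (fun x => 1 - Complex.exp (((A.indicator (1 : ℝ → ℝ) x * c : ℝ) : ℂ) * Complex.I)) =
      A.indicator fun _ => 1 - Complex.exp (c * Complex.I) := by
    funext x
    by_cases hx : x ∈ A <;> simp [hx]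
  rw [h2, integral_indicator_const _ hA, Complex.real_smul]

theorem map_ncard (hr : 0 < r) {A : Set ℝ} (hA : MeasurableSet A) (hv : volume A ≠ ∞) :
    (clockLaw r).map (fun ξ => ((hits A ξ).ncard : ℝ)) =
      (poissonMeasure (ENNReal.ofReal r * volume A).toNNReal).map ((↑) : ℕ → ℝ) := by
  have := isProbabilityMeasure_clockLaw hr
  have := Measure.isProbabilityMeasure_map (μ := clockLaw r) (measurable_ncard_hits hA).aemeasurable
  refine Measure.ext_of_charFun (funext fun c => ?_)
  rw [charFun_ncard hr hA hv, charFun_map_cast_poissonMeasure]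
  congr 1
  have h1 : (((ENNReal.ofReal r * volume A).toNNReal : ℝ≥0) : ℝ) = r * volume.real A := by
    rw [ENNReal.coe_toNNReal_eq_toReal, ENNReal.toReal_mul, ENNReal.toReal_ofReal hr.le]
    rfl
  rw [h1]
  push_cast
  ring

/-- Characteristic functions need real-valued counts; the floor carries the resulting laws and
independence back to `ℕ∞`. -/
theorem ae_encard_eq (hr : 0 < r) {A : Set ℝ} (hA : MeasurableSet A) (hv : volume A ≠ ∞) :
    ∀ᵐ ξ ∂clockLaw r, (hits A ξ).encard = (⌊((hits A ξ).ncard : ℝ)⌋₊ : ℕ∞) := by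
  filter_upwards [ae_finite_hits hr hA hv] with ξ hξ
  rw [Nat.floor_natCast, hξ.cast_ncard_eq]

theorem measurable_floor_enat : Measurable fun x : ℝ => ((⌊x⌋₊ : ℕ) : ℕ∞) :=
  (measurable_from_top (f := fun k : ℕ => (k : ℕ∞))).comp Nat.measurable_floor

theorem map_encard (hr : 0 < r) {A : Set ℝ} (hA : MeasurableSet A) (hv : volume A ≠ ∞) :
    (clockLaw r).map (fun ξ => (hits A ξ).encard) =
      (poissonMeasure (ENNReal.ofReal r * volume A).toNNReal).map ((↑) : ℕ → ℕ∞) := by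
  rw [Measure.map_congr (ae_encard_eq hr hA hv)]
  have h1 := Measure.map_map (μ := clockLaw r) measurable_floor_enat (measurable_ncard_hits hA)
  rw [Function.comp_def] at h1
  rw [← h1, map_ncard hr hA hv, Measure.map_map measurable_floor_enat measurable_from_top]
  congr 1
  funext k
  simp

/-- By disjointness at most one indicator is nonzero at each point, so `1 - exp(i ∑ c_j 1_{A_j})` is
the sum of the `1_{A_j} (1 - exp(i c_j))`. The exponent is additive and the joint characteristic
function factors. -/
theorem iIndepFun_ncard (hr : 0 < r) {ι : Type*} [Fintype ι] {A : ι → Set ℝ}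
    (hA : ∀ j, MeasurableSet (A j)) (hv : ∀ j, volume (A j) ≠ ∞)
    (hd : ∀ i j, i ≠ j → Disjoint (A i) (A j)) :
    iIndepFun (fun j ξ => ((hits (A j) ξ).ncard : ℝ)) (clockLaw r) := by
  have := isProbabilityMeasure_clockLaw hr
  refine (iIndepFun_iff_charFun_pi fun j => (measurable_ncard_hits (hA j)).aemeasurable).2
    fun c => ?_
  rw [charFun_ncardVector hr hA hv c]
  simp_rw [fun j => charFun_ncard hr (hA j) (hv j) (c.ofLp j)]
  rw [← Complex.exp_sum]
  congr 1
  have h1 : (fun x : ℝ => 1 - Complex.exp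
      (((∑ j, (A j).indicator (1 : ℝ → ℝ) x * c j : ℝ) : ℂ) * Complex.I)) =
      fun x => ∑ j, (A j).indicator (fun _ => 1 - Complex.exp (c j * Complex.I)) x := by
    funext x
    by_cases hx : ∃ k, x ∈ A k
    · obtain ⟨k, hk⟩ := hx
      have hne : ∀ j, j ≠ k → x ∉ A j := fun j hj hxj =>
        Set.disjoint_left.1 (hd j k hj) hxj hk
      rw [Finset.sum_eq_single k (fun j _ hj => by simp [hne j hj]) (by simp),
        Finset.sum_eq_single k (fun j _ hj => by simp [hne j hj]) (by simp)]
      simp [hk]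
    · have hne : ∀ j, x ∉ A j := fun j hxj => hx ⟨j, hxj⟩
      simp [hne]
  rw [h1, integral_finsetSum _ fun j _ =>
    (integrable_indicator_iff (hA j)).2 (integrableOn_const (hv j)), Finset.mul_sum,
    ← Finset.sum_neg_distrib]
  refine Finset.sum_congr rfl fun j _ => ?_
  rw [integral_indicator_const _ (hA j), Complex.real_smul]

theorem iIndepFun_encard_of_fintype (hr : 0 < r) {ι : Type*} [Fintype ι] {A : ι → Set ℝ}
    (hA : ∀ j, MeasurableSet (A j)) (hd : ∀ i j, i ≠ j → Disjoint (A i) (A j)) :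
    iIndepFun (fun j ξ => (hits (A j) ξ).encard) (clockLaw r) := by
  classical
  -- Sets of infinite measure have almost surely infinite count; they are replaced by `∅`, and the
  -- constant `⊤` is reinstated afterwards.
  set B : ι → Set ℝ := fun j => if volume (A j) = ∞ then ∅ else A j with hB
  have hBA : ∀ j, B j ⊆ A j := fun j => by
    simp only [hB]
    split_ifs
    · exact Set.empty_subset _
    · exact subset_rfl
  have hBm : ∀ j, MeasurableSet (B j) := fun j => by
    simp only [hB]
    split_ifs
    · exact MeasurableSet.empty
    · exact hA j
  have hBv : ∀ j, volume (B j) ≠ ∞ := fun j => by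
    simp only [hB]
    split_ifs with h
    · simp
    · exact h
  have h1 := (iIndepFun_ncard hr hBm hBv fun i j hij => (hd i j hij).mono (hBA i) (hBA j)).comp
    (fun j x => if volume (A j) = ∞ then ⊤ else ((⌊x⌋₊ : ℕ) : ℕ∞)) fun j => by
      by_cases h : volume (A j) = ∞
      · simpa only [h, if_true] using measurable_const
      · simpa only [h, if_false] using measurable_floor_enat
  refine h1.congr fun j => ?_
  by_cases h : volume (A j) = ∞
  · filter_upwards [ae_infinite_hits hr (hA j) h] with ξ hξ
    simp [h, hξ.encard_eq]
  · filter_upwards [ae_encard_eq hr (hA j) h] with ξ hξ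
    simp [h, hξ, hB]

theorem iIndepFun_encard (hr : 0 < r) {ι : Type*} {A : ι → Set ℝ}
    (hA : ∀ j, MeasurableSet (A j)) (hd : ∀ i j, i ≠ j → Disjoint (A i) (A j)) :
    iIndepFun (fun j ξ => (hits (A j) ξ).encard) (clockLaw r) :=
  iIndepFun_iff_finset.2 fun s => iIndepFun_encard_of_fintype hr (A := fun j : s => A j)
    (fun j => hA j) fun i j hij => hd i j (Subtype.coe_injective.ne hij)

/-! ### Invariance of the law of one clock under the shift -/

/-- The joint characteristic function sees the sets only through a Lebesgue integral, which is
translation invariant. -/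
theorem map_ncardVector_translate (hr : 0 < r) {ι : Type*} [Fintype ι] {A : ι → Set ℝ}
    (hA : ∀ j, MeasurableSet (A j)) (hv : ∀ j, volume (A j) ≠ ∞) (t : ℝ) :
    (clockLaw r).map (fun ξ => WithLp.toLp 2 fun j =>
      ((hits ((fun s => s - t) ⁻¹' A j) ξ).ncard : ℝ)) =
    (clockLaw r).map fun ξ => WithLp.toLp 2 fun j => ((hits (A j) ξ).ncard : ℝ) := by
  have := isProbabilityMeasure_clockLaw hr
  have hA' : ∀ j, MeasurableSet ((fun s => s - t) ⁻¹' A j) := fun j =>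
    (measurable_id.sub_const t) (hA j)
  have hv' : ∀ j, volume ((fun s => s - t) ⁻¹' A j) ≠ ∞ := fun j => by
    rw [(measurePreserving_sub_right volume t).measure_preimage (hA j).nullMeasurableSet]
    exact hv j
  have := Measure.isProbabilityMeasure_map (μ := clockLaw r)
    (measurable_ncardVector hA).aemeasurable
  have := Measure.isProbabilityMeasure_map (μ := clockLaw r)
    (measurable_ncardVector hA').aemeasurable
  refine Measure.ext_of_charFun (funext fun c => ?_)
  rw [charFun_ncardVector hr hA hv, charFun_ncardVector hr hA' hv']
  congr 3
  exact integral_sub_right_eq_self (fun x : ℝ => 1 - Complex.exp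
      (((∑ j, (A j).indicator (1 : ℝ → ℝ) x * c j : ℝ) : ℂ) * Complex.I)) t

/-- The interval between `0` and `a`. -/
noncomputable def spanIco (a : ℝ) : Set ℝ := if 0 ≤ a then Set.Ico 0 a else Set.Ico a 0

theorem measurableSet_spanIco (a : ℝ) : MeasurableSet (spanIco a) := by
  unfold spanIco
  split_ifs <;> exact measurableSet_Ico

theorem volume_spanIco_ne_top (a : ℝ) : volume (spanIco a) ≠ ∞ := by
  unfold spanIco
  split_ifs <;> simp

/-- Index `0` belongs to the first nonnegative jump, so indices are signed counts from the origin.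
This expresses events about jump times through counts. -/
theorem IsClock.firstIndex_eq {ξ : ℤ → ℝ} (h : IsClock ξ) (a : ℝ) :
    ((firstIndex ξ a : ℤ) : ℝ) = (if 0 ≤ a then 1 else -1) * ((hits (spanIco a) ξ).ncard : ℝ) := by
  by_cases ha : 0 ≤ a
  · have h1 : hits (spanIco a) ξ = (Finset.Ico 0 (firstIndex ξ a) : Finset ℤ) := by
      ext l
      rw [Finset.coe_Ico, Set.mem_Ico, ← h.nonneg_iff, ← not_le (b := l), h.firstIndex_le_iff,
        not_le]
      simp [hits, spanIco, ha]
    have h2 : 0 ≤ firstIndex ξ a := by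
      rw [← h.nonneg_iff]
      exact ha.trans ((h.firstIndex_le_iff a _).1 le_rfl)
    rw [if_pos ha, one_mul, h1, Set.ncard_coe_finset, Int.card_Ico]
    have : (((firstIndex ξ a - 0).toNat : ℤ) : ℝ) = (firstIndex ξ a : ℝ) := by
      congr 1
      omega
    exact_mod_cast this.symm
  · have h1 : hits (spanIco a) ξ = (Finset.Ico (firstIndex ξ a) 0 : Finset ℤ) := by
      ext l
      rw [Finset.coe_Ico, Set.mem_Ico, h.firstIndex_le_iff, ← not_le (b := l), ← h.nonneg_iff,
        not_le]
      simp [hits, spanIco, ha]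
    have h2 : firstIndex ξ a ≤ 0 := by
      rw [h.firstIndex_le_iff]
      exact (not_le.1 ha).le.trans ((h.nonneg_iff 0).2 le_rfl)
    rw [if_neg ha, h1, Set.ncard_coe_finset, Int.card_Ico]
    have : -(((0 - firstIndex ξ a).toNat : ℤ) : ℝ) = (firstIndex ξ a : ℝ) := by
      rw [← Int.cast_neg]
      congr 1
      omega
    rw [← this]
    push_cast
    ring

theorem IsClock.jumpTime_lt_iff {ξ : ℤ → ℝ} (h : IsClock ξ) (l : ℤ) (a : ℝ) :
    jumpTime ξ l < a ↔
      (l : ℝ) < (if 0 ≤ a then 1 else -1) * ((hits (spanIco a) ξ).ncard : ℝ) := by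
  rw [← h.firstIndex_eq, Int.cast_lt, ← not_le, ← not_le, h.firstIndex_le_iff]

theorem encard_hits_shiftClock (A : Set ℝ) (t : ℝ) (ξ : ℤ → ℝ) :
    (hits A (shiftClock t ξ)).encard = (hits ((fun s => s - t) ⁻¹' A) ξ).encard := by
  have h : hits ((fun s => s - t) ⁻¹' A) ξ =
      (fun l => l + firstIndex ξ t) '' hits A (shiftClock t ξ) := by
    ext l
    constructor
    · intro hl
      refine ⟨l - firstIndex ξ t, ?_, sub_add_cancel _ _⟩
      change jumpTime _ _ ∈ A
      rw [jumpTime_shiftClock, sub_add_cancel]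
      exact hl
    · rintro ⟨k, hk, rfl⟩
      change jumpTime _ _ ∈ A at hk
      rw [jumpTime_shiftClock] at hk
      exact hk
  rw [h, (add_left_injective _).encard_image]

theorem ncard_hits_shiftClock (A : Set ℝ) (t : ℝ) (ξ : ℤ → ℝ) :
    (hits A (shiftClock t ξ)).ncard = (hits ((fun s => s - t) ⁻¹' A) ξ).ncard :=
  congrArg ENat.toNat (encard_hits_shiftClock A t ξ)

/-- The event that the jump time `p.1` precedes `p.2`, for all `p` in `s`. -/
def jumpsBefore (s : Finset (ℤ × ℝ)) : Set (ℤ → ℝ) := {ξ | ∀ p ∈ s, jumpTime ξ p.1 < p.2}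

theorem measurableSet_jumpsBefore (s : Finset (ℤ × ℝ)) : MeasurableSet (jumpsBefore s) := by
  unfold jumpsBefore
  simp only [Set.ofPred_forall]
  exact Finset.measurableSet_biInter s fun p _ =>
    measurableSet_lt (measurable_jumpTime _) measurable_const

theorem isPiSystem_jumpsBefore : IsPiSystem (Set.range jumpsBefore) := by
  classical
  rintro _ ⟨s, rfl⟩ _ ⟨t, rfl⟩ -
  refine ⟨s ∪ t, ?_⟩
  ext ξ
  simp only [jumpsBefore, Set.mem_ofPred_eq, Set.mem_inter_iff, Finset.mem_union]
  exact ⟨fun h => ⟨fun p hp => h p (Or.inl hp), fun p hp => h p (Or.inr hp)⟩,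
    fun h p hp => hp.elim (h.1 p) (h.2 p)⟩

/-- The events make each jump time measurable, and the gaps are measurable functions of the jump
times. -/
theorem generateFrom_jumpsBefore :
    (MeasurableSpace.pi : MeasurableSpace (ℤ → ℝ)) =
      MeasurableSpace.generateFrom (Set.range jumpsBefore) := by
  refine le_antisymm ?_ (MeasurableSpace.generateFrom_le ?_)
  · have h1 : ∀ l, Measurable[MeasurableSpace.generateFrom (Set.range jumpsBefore)]
        fun ξ : ℤ → ℝ => jumpTime ξ l := fun l => by
      refine @measurable_of_Iio ℝ (ℤ → ℝ) _ _ _ (MeasurableSpace.generateFrom _) _ _ _ _ fun a => ?_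
      refine MeasurableSpace.measurableSet_generateFrom ⟨{(l, a)}, ?_⟩
      ext ξ
      simp [jumpsBefore]
    have h2 : Measurable[MeasurableSpace.generateFrom (Set.range jumpsBefore)] jumpTime :=
      @measurable_pi_lambda _ _ _ (MeasurableSpace.generateFrom _) _ _ h1
    have h3 := measurable_gaps.comp h2
    have h4 : gaps ∘ jumpTime = id := funext gaps_jumpTime
    rw [h4] at h3
    exact fun s hs => h3 hs
  · rintro _ ⟨s, rfl⟩
    exact measurableSet_jumpsBefore s

/-- Up to null sets each event of the generating π-system is a condition on finitely many counts,
and shifting the clock translates the sets being counted. -/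
theorem map_shift_clockLaw (hr : 0 < r) (t : ℝ) {f : (ℤ → ℝ) → ℤ → ℝ} (hf : Measurable f)
    (hft : ∀ ξ, IsClock ξ → f ξ = shiftClock t ξ) : (clockLaw r).map f = clockLaw r := by
  have := isProbabilityMeasure_clockLaw hr
  have := Measure.isProbabilityMeasure_map (μ := clockLaw r) hf.aemeasurable
  refine ext_of_generate_finite _ generateFrom_jumpsBefore isPiSystem_jumpsBefore ?_ (by simp)
  rintro _ ⟨s, rfl⟩
  rw [Measure.map_apply hf (measurableSet_jumpsBefore s)]
  set A : s → Set ℝ := fun p => spanIco p.1.2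
  have hA : ∀ p, MeasurableSet (A p) := fun p => measurableSet_spanIco _
  have hA' : ∀ p, MeasurableSet ((fun s => s - t) ⁻¹' A p) := fun p =>
    (measurable_id.sub_const t) (hA p)
  set S : Set (EuclideanSpace ℝ s) :=
    {v | ∀ p : s, (p.1.1 : ℝ) < (if 0 ≤ p.1.2 then 1 else -1) * v p} with hS
  have hSm : MeasurableSet S := by
    simp only [hS, Set.ofPred_forall]
    exact MeasurableSet.iInter fun p => measurableSet_lt measurable_const (by fun_prop)
  have h1 : f ⁻¹' jumpsBefore s =ᵐ[clockLaw r] (fun ξ => WithLp.toLp 2 fun p =>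
      ((hits ((fun s => s - t) ⁻¹' A p) ξ).ncard : ℝ)) ⁻¹' S := by
    filter_upwards [ae_isClock hr] with ξ hξ
    refine propext ?_
    change (∀ p ∈ s, jumpTime (f ξ) p.1 < p.2) ↔ ∀ p : s, _ < _ * _
    rw [hft ξ hξ, Subtype.forall]
    refine forall₂_congr fun p hp => ?_
    rw [(hξ.shift t).jumpTime_lt_iff, ncard_hits_shiftClock]
  have h2 : jumpsBefore s =ᵐ[clockLaw r] (fun ξ => WithLp.toLp 2 fun p =>
      ((hits (A p) ξ).ncard : ℝ)) ⁻¹' S := by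
    filter_upwards [ae_isClock hr] with ξ hξ
    refine propext ?_
    change (∀ p ∈ s, jumpTime ξ p.1 < p.2) ↔ ∀ p : s, _ < _ * _
    rw [Subtype.forall]
    refine forall₂_congr fun p hp => ?_
    rw [hξ.jumpTime_lt_iff]
  rw [measure_congr h1, measure_congr h2,
    ← Measure.map_apply (measurable_ncardVector hA') hSm,
    ← Measure.map_apply (measurable_ncardVector hA) hSm,
    map_ncardVector_translate hr hA (fun p => volume_spanIco_ne_top _) t]

end TASEP

/-! ### The joint law of all clocks -/

theorem iIndepFun_comp_measurePreserving {Ω Ω' ι : Type*} [MeasurableSpace Ω]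
    [MeasurableSpace Ω'] {β : ι → Type*} [∀ i, MeasurableSpace (β i)]
    {μ : Measure Ω} {ν : Measure Ω'} [IsProbabilityMeasure μ] [IsProbabilityMeasure ν]
    {T : Ω' → Ω} (hT : MeasurePreserving T ν μ) {f : ∀ i, Ω → β i} (hf : ∀ i, Measurable (f i))
    (h : iIndepFun f μ) : iIndepFun (fun i ω => f i (T ω)) ν := by
  rw [iIndepFun_iff_map_fun_eq_infinitePi_map hf] at h
  refine (iIndepFun_iff_map_fun_eq_infinitePi_map (X := fun i ω => f i (T ω))
    fun i => (hf i).comp hT.measurable).2 ?_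
  have h1 : ν.map (fun ω i => f i (T ω)) = μ.map fun ω i => f i ω := by
    rw [← hT.map_eq, Measure.map_map (measurable_pi_iff.2 hf) hT.measurable]
    rfl
  have h2 : ∀ i, ν.map (fun ω => f i (T ω)) = μ.map (f i) := fun i => by
    rw [← hT.map_eq, Measure.map_map (hf i) hT.measurable]
    rfl
  rw [h1, h]
  simp_rw [h2]

namespace TASEP

theorem measurableSet_encard_hits_eq {A : Set ℝ} (hA : MeasurableSet A) (k : ℕ∞) :
    MeasurableSet {ξ | (hits A ξ).encard = k} :=
  measurable_encard_hits hA (show MeasurableSet {k} from trivial)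

theorem clockLaw_encard_eq {r : ℝ} (hr : 0 < r) {A : Set ℝ} (hA : MeasurableSet A)
    (hv : volume A ≠ ∞) (k : ℕ) :
    clockLaw r {ξ | (hits A ξ).encard = k} =
      poissonMeasure (ENNReal.ofReal r * volume A).toNNReal {k} := by
  have h1 : clockLaw r {ξ | (hits A ξ).encard = k} =
      (clockLaw r).map (fun ξ => (hits A ξ).encard) {(k : ℕ∞)} := by
    rw [Measure.map_apply (measurable_encard_hits hA) trivial]
    rfl
  rw [h1, map_encard hr hA hv, Measure.map_apply measurable_from_top
    (show MeasurableSet {(k : ℕ∞)} from trivial)]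
  congr 1
  ext m
  simp

/-- The count in `{c}` is Poisson with mean zero, so no density of the jump times is needed. -/
theorem clockLaw_jumpTime_eq {r : ℝ} (hr : 0 < r) (l : ℤ) (c : ℝ) :
    clockLaw r {ξ | jumpTime ξ l = c} = 0 := by
  have := isProbabilityMeasure_clockLaw hr
  have h1 := clockLaw_encard_eq hr (measurableSet_singleton c) (by simp) 0
  have h2 : clockLaw r {ξ | (hits {c} ξ).encard = (0 : ℕ)} = 1 := by
    rw [h1, poissonMeasure_singleton]
    simp
  refine measure_mono_null (fun ξ hξ => ?_) ((prob_compl_eq_zero_iff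
    (measurableSet_encard_hits_eq (measurableSet_singleton c) _)).2 h2)
  intro h
  change (hits {c} ξ).encard = 0 at h
  have hmem : l ∈ hits {c} ξ := hξ
  rw [Set.encard_eq_zero.1 h] at hmem
  exact hmem

variable {n : ℕ} {ρ : Fin (n + 1) → ℝ}

/-- The law of `n + 1` independent clocks with the rates `ρ`. -/
noncomputable def sampleLaw (ρ : Fin (n + 1) → ℝ) : Measure (Sample n) :=
  (Measure.pi fun k => clockLaw (ρ k)).comap Subtype.val

theorem ae_isAdmissible (hρ : ∀ k, 0 < ρ k) :
    ∀ᵐ ω ∂Measure.pi fun k => clockLaw (ρ k), IsAdmissible ω := by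
  have := fun k => isProbabilityMeasure_clockLaw (hρ k)
  have h1 : ∀ k, ∀ᵐ ω ∂Measure.pi fun k => clockLaw (ρ k), IsClock (ω k) := fun k =>
    (measurePreserving_eval (fun k => clockLaw (ρ k)) k).quasiMeasurePreserving.ae
      (ae_isClock (hρ k))
  have hind : iIndepFun (fun (k : Fin (n + 1)) (ω : Fin (n + 1) → ℤ → ℝ) => ω k)
      (Measure.pi fun k => clockLaw (ρ k)) :=
    iIndepFun_pi (X := fun _ x => x) fun k => aemeasurable_id
  have h2 : ∀ k k', k ≠ k' → ∀ j j', ∀ᵐ ω ∂Measure.pi fun k => clockLaw (ρ k),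
      jumpTime (ω k) j ≠ jumpTime (ω k') j' := fun k k' hk j j' => by
    have hm : MeasurableSet {p : (ℤ → ℝ) × (ℤ → ℝ) | jumpTime p.2 j = jumpTime p.1 j'} :=
      measurableSet_eq_fun (by fun_prop) (by fun_prop)
    have hp := (indepFun_iff_map_prod_eq_prod_map_map (measurable_pi_apply k').aemeasurable
      (measurable_pi_apply k).aemeasurable).1 (hind.indepFun hk.symm)
    rw [(measurePreserving_eval (fun k => clockLaw (ρ k)) k').map_eq,
      (measurePreserving_eval (fun k => clockLaw (ρ k)) k).map_eq] at hp
    -- By Fubini the jump time of one clock is fixed, and the independent other clock almost surely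
    -- does not ring at that time.
    have h0 : ((clockLaw (ρ k')).prod (clockLaw (ρ k)))
        {p : (ℤ → ℝ) × (ℤ → ℝ) | jumpTime p.2 j = jumpTime p.1 j'} = 0 := by
      rw [Measure.measure_prod_null hm]
      exact ae_of_all _ fun η => clockLaw_jumpTime_eq (hρ k) j (jumpTime η j')
    rw [← hp, Measure.map_apply (by fun_prop) hm] at h0
    refine measure_mono_null (fun ω hω => ?_) h0
    simpa using hω
  filter_upwards [ae_all_iff.2 h1, ae_all_iff.2 fun k => ae_all_iff.2 fun k' =>
    ae_all_iff.2 fun hk => ae_all_iff.2 fun j => ae_all_iff.2 fun j' => h2 k k' hk j j']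
    with ω h1 h2
  exact ⟨h1, h2⟩

/-- Admissible families have full measure, so restricting to them loses no mass. -/
theorem measurePreserving_val (hρ : ∀ k, 0 < ρ k) :
    MeasurePreserving (Subtype.val : Sample n → _) (sampleLaw ρ)
      (Measure.pi fun k => clockLaw (ρ k)) := by
  refine ⟨measurable_subtype_coe, ?_⟩
  rw [sampleLaw, measurableEmbedding_sample.map_comap]
  exact Measure.restrict_eq_self_of_ae_mem
    ((ae_isAdmissible hρ).mono fun ω hω => ⟨⟨ω, hω⟩, rfl⟩)

theorem isProbabilityMeasure_sampleLaw (hρ : ∀ k, 0 < ρ k) :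
    IsProbabilityMeasure (sampleLaw ρ) := by
  have := fun k => isProbabilityMeasure_clockLaw (hρ k)
  constructor
  rw [← Set.preimage_univ (f := Subtype.val),
    (measurePreserving_val hρ).measure_preimage MeasurableSet.univ.nullMeasurableSet, measure_univ]

theorem measurePreserving_clock (hρ : ∀ k, 0 < ρ k) (k : Fin (n + 1)) :
    MeasurePreserving (fun ω : Sample n => ω.1 k) (sampleLaw ρ) (clockLaw (ρ k)) := by
  have := fun k => isProbabilityMeasure_clockLaw (hρ k)
  exact (measurePreserving_eval (fun k => clockLaw (ρ k)) k).comp (measurePreserving_val hρ)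

theorem iIndepFun_clocks (hρ : ∀ k, 0 < ρ k) :
    iIndepFun (fun (k : Fin (n + 1)) (ω : Sample n) => ω.1 k) (sampleLaw ρ) := by
  have := isProbabilityMeasure_sampleLaw hρ
  rw [iIndepFun_iff_map_fun_eq_pi_map fun k => (measurable_clock k).aemeasurable]
  simp_rw [fun k => (measurePreserving_clock hρ k).map_eq]
  exact (measurePreserving_val hρ).map_eq

/-- The shift acts on each clock separately: independence survives and each marginal is preserved,
so the product law is too. -/
theorem measurePreserving_θ (hρ : ∀ k, 0 < ρ k) (t : ℝ) :
    MeasurePreserving (θ t) (sampleLaw ρ) (sampleLaw ρ) := by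
  have := isProbabilityMeasure_sampleLaw hρ
  have hθm : Measurable (θ (n := n) t) := by
    have h1 : Measurable fun ω : Sample n => ((t, ω) : ℝ × Sample n) :=
      measurable_const.prodMk measurable_id
    exact measurable_θ.comp h1
  refine ⟨hθm, ?_⟩
  -- `f` extends the shift measurably from clocks to all sequences, as composition with independent
  -- coordinates requires.
  obtain ⟨f, hf, hfs⟩ := (MeasurableEmbedding.subtype_coe
    measurableSet_isClock).exists_measurable_extend
    (g := fun ξ : {ξ : ℤ → ℝ // IsClock ξ} => shiftClock t ξ.1)
    (measurable_shiftClock.comp (measurable_const.prodMk measurable_id)) fun _ => inferInstance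
  have hft : ∀ ξ, IsClock ξ → f ξ = shiftClock t ξ := fun ξ hξ => congrFun hfs ⟨ξ, hξ⟩
  have hind := (iIndepFun_clocks hρ).comp (fun _ => f) fun _ => hf
  rw [iIndepFun_iff_map_fun_eq_pi_map fun k => (hf.comp (measurable_clock k)).aemeasurable] at hind
  have h1 : ∀ k, (sampleLaw ρ).map (f ∘ fun ω : Sample n => ω.1 k) = clockLaw (ρ k) := fun k => by
    rw [← Measure.map_map hf (measurable_clock k), (measurePreserving_clock hρ k).map_eq,
      map_shift_clockLaw (hρ k) t hf hft]
  simp_rw [h1] at hind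
  have h2 : ((sampleLaw ρ).map (θ t)).map Subtype.val = Measure.pi fun k => clockLaw (ρ k) := by
    rw [Measure.map_map measurable_subtype_coe hθm, ← hind]
    congr 1
    funext ω k
    exact (hft _ (ω.2.clock k)).symm
  rw [← measurableEmbedding_sample.comap_map ((sampleLaw ρ).map (θ t)), h2]
  rfl

theorem encard_points_inter (ω : Sample n) (k : Fin (n + 1)) (A : Set ℝ) :
    (points (ω.1 k) ∩ A).encard = (hits A (ω.1 k)).encard :=
  ((ω.2.clock k).encard_hits A).symm

theorem isHomogeneousPoissonProcess_points (hρ : ∀ k, 0 < ρ k) (k : Fin (n + 1)) :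
    IsHomogeneousPoissonProcess (sampleLaw ρ) (fun ω => points (ω.1 k)) (ρ k) := by
  have := isProbabilityMeasure_clockLaw (hρ k)
  have := isProbabilityMeasure_sampleLaw hρ
  have hT := measurePreserving_clock hρ k
  refine ⟨fun ω => Set.countable_range _, fun A hA => ?_, fun p A hA hd => ?_, fun A hA hv => ?_,
    fun A hA hv => ?_⟩ <;> simp only [encard_points_inter]
  · exact (measurable_encard_hits hA).comp hT.measurable
  · exact iIndepFun_comp_measurePreserving hT (fun i => measurable_encard_hits (hA i))
      (iIndepFun_encard (hρ k) hA hd)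
  · rw [← map_encard (hρ k) hA hv, ← hT.map_eq,
      Measure.map_map (measurable_encard_hits hA) hT.measurable]
    rfl
  · filter_upwards [hT.quasiMeasurePreserving.ae (ae_infinite_hits (hρ k) hA hv)] with ω hω
    exact hω.encard_eq

theorem rate_pos {α β : ℝ} (hα : 0 < α) (hβ : 0 < β) {h : ℕ → ℝ}
    (hh : ∀ k, 1 ≤ k → k < n → 0 < h k) (k : Fin (n + 1)) : 0 < rate n α β h k := by
  unfold rate
  split_ifs with h0 h1
  · exact hα
  · exact hβ
  · exact hh k (Nat.one_le_iff_ne_zero.2 h0) (by omega)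

theorem isRDS (hρ : ∀ k, 0 < ρ k) : RDS.IsRDS (sampleLaw ρ) θ (φ (n := n)) where
  isProbabilityMeasure := isProbabilityMeasure_sampleLaw hρ
  borelSpace := ⟨(borel_eq_top_of_discrete (α := State n)).symm⟩
  system := ⟨θ_zero, θ_add, measurable_θ, measurePreserving_θ hρ⟩
  init := φ_zero
  cocycle := φ_add
  measurable := measurable_φ
  continuous _ _ := continuous_of_discreteTopology

end TASEP

namespace RDS

theorem semiDist_self {X : Type*} [PseudoEMetricSpace X] (A : Set X) : semiDist A A = 0 :=
  le_antisymm (iSup₂_le fun a ha => (iInf₂_le a ha).trans (edist_self a).le) bot_le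

end RDS

namespace TASEP

variable {n : ℕ}

/-! ### A synchronizing word -/

/-- A full final segment cannot lose a particle: inside it every right neighbour is occupied, and `k
< n` rules out the exit. -/
theorem hop_apply_of_lt {m : ℕ} {x : Fin n → Bool} (hx : ∀ i : Fin n, m ≤ i → x i = true)
    {k : Fin (n + 1)} (hk : (k : ℕ) < n) (i : Fin n) (hi : m ≤ i) : hop x k i = true := by
  unfold hop
  split_ifs
  all_goals first
    | rfl
    | exact hx i hi
    | omega
    | skip
  obtain ⟨a, b, ha, hb, -, hxb⟩ := ‹∃ a b : Fin n, _›
  rw [hx b (by omega)] at hxb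
  exact absurd hxb (by decide)

theorem hop_zero_apply_zero (x : Fin n → Bool) (hn : 0 < n) : hop x 0 ⟨0, hn⟩ = true := by
  simp [hop]

/-- Either the target is empty and the particle moves there, or the attempt is void because the
target is already occupied. -/
theorem hop_apply_target (x : Fin n → Bool) {j : ℕ} (hj : j + 1 < n)
    (hx : x ⟨j, by omega⟩ = true) : hop x ⟨j + 1, by omega⟩ ⟨j + 1, hj⟩ = true := by
  unfold hop
  rw [if_neg (by simp), if_neg (by simp only; omega)]
  cases hb : x ⟨j + 1, hj⟩ with
  | false =>
    rw [if_pos ⟨⟨j, by omega⟩, ⟨j + 1, hj⟩, rfl, rfl, hx, hb⟩, if_neg (by simp), if_pos (by simp)]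
  | true =>
    split_ifs <;> simp_all

theorem foldl_hopState_apply_of_lt {m : ℕ} (w : List (Fin (n + 1)))
    (hw : ∀ k ∈ w, (k : ℕ) < n) {x : State n} (hx : ∀ i : Fin n, m ≤ i → x i = true) :
    ∀ i : Fin n, m ≤ i → w.foldl hopState x i = true := by
  induction w generalizing x with
  | nil => exact hx
  | cons k w ih =>
    exact ih (fun k' hk' => hw k' (List.mem_cons_of_mem _ hk'))
      (hop_apply_of_lt hx (hw k List.mem_cons_self))

/-- The letters `0, 1, …, j` bring in a particle and push it on; at each stage it moves or finds its
target occupied. -/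
theorem exists_word_occupying (j : ℕ) (hj : j < n) :
    ∃ w : List (Fin (n + 1)), (∀ k ∈ w, (k : ℕ) < n) ∧
      ∀ x : State n, w.foldl hopState x ⟨j, hj⟩ = true := by
  induction j with
  | zero =>
    refine ⟨[0], by simpa using hj, fun x => hop_zero_apply_zero x hj⟩
  | succ j ih =>
    obtain ⟨w, hw, hwx⟩ := ih (by omega)
    refine ⟨w ++ [⟨j + 1, by omega⟩], ?_, fun x => ?_⟩
    · intro k hk
      rcases List.mem_append.1 hk with h | h
      · exact hw k h
      · rw [List.mem_singleton.1 h]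
        exact hj
    · rw [List.foldl_append]
      exact hop_apply_target _ hj (hwx x)

/-- Sites are filled from the right end, since a full final segment is not disturbed by later
letters below `n`. -/
theorem exists_word_filling (m : ℕ) (hm : m ≤ n) :
    ∃ w : List (Fin (n + 1)), (∀ k ∈ w, (k : ℕ) < n) ∧
      ∀ (x : State n) (i : Fin n), n - m ≤ i → w.foldl hopState x i = true := by
  induction m with
  | zero => exact ⟨[], by simp, fun x i hi => by omega⟩
  | succ m ih =>
    obtain ⟨w, hw, hwx⟩ := ih (by omega)
    obtain ⟨w', hw', hwx'⟩ := exists_word_occupying (n := n) (n - (m + 1)) (by omega)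
    refine ⟨w ++ w', fun k hk => (List.mem_append.1 hk).elim (hw k) (hw' k), fun x i hi => ?_⟩
    rw [List.foldl_append]
    by_cases h : n - m ≤ i
    · exact foldl_hopState_apply_of_lt w' hw' (hwx x) i h
    · have : i = ⟨n - (m + 1), by omega⟩ := Fin.ext (by simp only; omega)
      rw [this]
      exact hwx' _

theorem exists_synchronizing_word (n : ℕ) :
    ∃ (w : List (Fin (n + 1))) (a : State n), ∀ x : State n, w.foldl hopState x = a := by
  obtain ⟨w, -, hw⟩ := exists_word_filling (n := n) n le_rfl
  exact ⟨w, fun _ => true, fun x => funext fun i => hw x i (by omega)⟩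

/-! ### Realizing a word -/

/-- In the unit intervals following time `τ`, the clocks ring according to the word `w`. -/
def Spells (w : List (Fin (n + 1))) (τ : ℝ) (ω : Sample n) : Prop :=
  ∀ (k : Fin (n + 1)) (j : Fin w.length),
    (hits (Set.Ico (τ + (j : ℝ)) (τ + (j : ℝ) + 1)) (ω.1 k)).encard =
      ((if w.get j = k then 1 else 0 : ℕ) : ℕ∞)

theorem Spells.shift {w : List (Fin (n + 1))} {τ : ℝ} {ω : Sample n} (h : Spells w τ ω) :
    Spells w 0 (θ τ ω) := fun k j => by
  rw [← h k j]
  change (hits _ (shiftClock τ (ω.1 k))).encard = _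
  rw [encard_hits_shiftClock]
  congr 2
  ext s
  simp only [Set.mem_preimage, Set.mem_Ico]
  constructor <;> rintro ⟨h1, h2⟩ <;> constructor <;> linarith

/-- Each unit interval contains exactly one ring, that of the prescribed clock, so reading the rings
in order of time gives `w`. -/
theorem Spells.φ_eq {w : List (Fin (n + 1))} {ω : Sample n} (h : Spells w 0 ω) (x : State n) :
    φ (w.length : ℝ≥0) x ω = w.foldl hopState x := by
  have hex : ∀ j : Fin w.length, ∃ l : ℤ,
      hits (Set.Ico (0 + (j : ℝ)) (0 + (j : ℝ) + 1)) (ω.1 (w.get j)) = {l} := fun j => by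
    have h1 := h (w.get j) j
    rw [if_pos rfl, Nat.cast_one] at h1
    exact Set.encard_eq_one.1 h1
  choose l hl using hex
  have hlm : ∀ j : Fin w.length, (j : ℝ) ≤ jumpTime (ω.1 (w.get j)) (l j) ∧
      jumpTime (ω.1 (w.get j)) (l j) < j + 1 := fun j => by
    have h1 : l j ∈ hits (Set.Ico (0 + (j : ℝ)) (0 + (j : ℝ) + 1)) (ω.1 (w.get j)) := by
      rw [hl j]
      rfl
    simpa [hits] using h1
  have hL : ListsJumps ω ((w.length : ℝ≥0) : ℝ) (List.ofFn fun j => (w.get j, l j)) := by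
    refine ⟨?_, ?_, ?_⟩
    · rw [List.pairwise_ofFn]
      intro i j hij
      have h1 : ((i : ℕ) : ℝ) + 1 ≤ (j : ℕ) := by exact_mod_cast hij
      exact ((hlm i).2.trans_le h1).trans_le (hlm j).1
    · intro p hp
      obtain ⟨j, rfl⟩ := (List.mem_ofFn' _ _).1 hp
      refine ⟨(Nat.cast_nonneg _).trans (hlm j).1, (hlm j).2.trans_le ?_⟩
      have : (j : ℕ) + 1 ≤ w.length := j.2
      push_cast
      exact_mod_cast this
    · intro p h0 h1
      -- The integer part of a jump time is the index of its unit interval.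
      have hlt : ⌊jumpTime (ω.1 p.1) p.2⌋₊ < w.length := by
        rw [Nat.floor_lt h0]
        simpa using h1
      set j : Fin w.length := ⟨⌊jumpTime (ω.1 p.1) p.2⌋₊, hlt⟩ with hj
      have hmem : p.2 ∈ hits (Set.Ico (0 + (j : ℝ)) (0 + (j : ℝ) + 1)) (ω.1 p.1) := by
        simp only [hits, zero_add, Set.mem_ofPred_eq, Set.mem_Ico, hj]
        exact ⟨Nat.floor_le h0, Nat.lt_floor_add_one _⟩
      have hk : w.get j = p.1 := by
        by_contra hne
        have h2 := h p.1 j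
        rw [if_neg hne, Nat.cast_zero, Set.encard_eq_zero] at h2
        rw [h2] at hmem
        exact hmem
      refine (List.mem_ofFn' _ _).2 ⟨j, Prod.ext hk ?_⟩
      rw [← hk, hl j] at hmem
      exact hmem.symm
  rw [hL.φ_eq]
  congr 1
  rw [List.map_ofFn]
  exact List.ofFn_get w

/-! ### Every word is spelled almost surely -/

variable {ρ : Fin (n + 1) → ℝ}

theorem iIndepFun_counts (hρ : ∀ k, 0 < ρ k) {ι : Type*} {A : ι → Set ℝ}
    (hA : ∀ j, MeasurableSet (A j)) (hd : ∀ i j, i ≠ j → Disjoint (A i) (A j)) :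
    iIndepFun (fun (p : Fin (n + 1) × ι) (ω : Sample n) => (hits (A p.2) (ω.1 p.1)).encard)
      (sampleLaw ρ) := by
  have := fun k => isProbabilityMeasure_clockLaw (hρ k)
  have := isProbabilityMeasure_sampleLaw hρ
  refine iIndepFun_uncurry' (X := fun (k : Fin (n + 1)) (j : ι) (ω : Sample n) =>
    (hits (A j) (ω.1 k)).encard)
    (fun k j => (measurable_encard_hits (hA j)).comp (measurable_clock k)) ?_ fun k => ?_
  · exact (iIndepFun_clocks hρ).comp (fun _ ξ j => (hits (A j) ξ).encard) fun _ =>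
      measurable_pi_iff.2 fun j => measurable_encard_hits (hA j)
  · exact iIndepFun_comp_measurePreserving (measurePreserving_clock hρ k)
      (fun j => measurable_encard_hits (hA j)) (iIndepFun_encard (hρ k) hA hd)

theorem disjoint_cells {L : ℕ} {z : ℕ → ℤ} (hz : Function.Injective z) (p q : ℕ × Fin L)
    (hpq : p ≠ q) :
    Disjoint (Set.Ico (((z p.1 * L : ℤ) : ℝ) + ((p.2 : ℕ) : ℝ))
        (((z p.1 * L : ℤ) : ℝ) + ((p.2 : ℕ) : ℝ) + 1))
      (Set.Ico (((z q.1 * L : ℤ) : ℝ) + ((q.2 : ℕ) : ℝ))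
        (((z q.1 * L : ℤ) : ℝ) + ((q.2 : ℕ) : ℝ) + 1)) := by
  rw [Set.disjoint_left]
  rintro s ⟨h1, h2⟩ ⟨h3, h4⟩
  have h5 : ((z p.1 * L + (p.2 : ℕ) : ℤ) : ℝ) < ((z q.1 * L + (q.2 : ℕ) + 1 : ℤ) : ℝ) := by
    push_cast at *
    linarith
  have h6 : ((z q.1 * L + (q.2 : ℕ) : ℤ) : ℝ) < ((z p.1 * L + (p.2 : ℕ) + 1 : ℤ) : ℝ) := by
    push_cast at *
    linarith
  have h7 := Int.cast_lt.1 h5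
  have h8 := Int.cast_lt.1 h6
  have h9 : z p.1 * L + (p.2 : ℕ) = z q.1 * L + (q.2 : ℕ) := by omega
  have hp := p.2.2
  have hq := q.2.2
  have h10 : ((p.2 : ℕ) : ℤ) = (q.2 : ℕ) := by
    -- Uniqueness of division by `L`: the left endpoint of a cell determines its block and its
    -- position in the block.
    have := congrArg (· % (L : ℤ)) h9
    simp only [Int.mul_add_emod_self_right] at this
    rwa [Int.emod_eq_of_lt (by omega) (by omega), Int.emod_eq_of_lt (by omega) (by omega)] at this
  have h11 : z p.1 = z q.1 := by
    rw [h10, add_left_inj] at h9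
    exact mul_right_cancel₀ (by omega) h9
  exact hpq (Prod.ext (hz h11) (Fin.ext (by omega)))

/-- Second Borel-Cantelli for independent events of equal positive probability. The injection `z`
selects the blocks, so that both future and past can be treated. -/
theorem ae_exists_spells (hρ : ∀ k, 0 < ρ k) (w : List (Fin (n + 1))) {z : ℕ → ℤ}
    (hz : Function.Injective z) :
    ∀ᵐ ω ∂sampleLaw ρ, ∃ m : ℕ, Spells w ((z m * w.length : ℤ) : ℝ) ω := by
  have := fun k => isProbabilityMeasure_clockLaw (hρ k)
  have := isProbabilityMeasure_sampleLaw hρ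
  set A : ℕ × Fin w.length → Set ℝ := fun q =>
    Set.Ico (((z q.1 * w.length : ℤ) : ℝ) + ((q.2 : ℕ) : ℝ))
      (((z q.1 * w.length : ℤ) : ℝ) + ((q.2 : ℕ) : ℝ) + 1)
    with hAdef
  have hA : ∀ q, MeasurableSet (A q) := fun q => measurableSet_Ico
  have hind := iIndepFun_counts hρ hA fun p q hpq => disjoint_cells hz p q hpq
  set c : Fin (n + 1) × ℕ × Fin w.length → ℕ := fun p => if w.get p.2.2 = p.1 then 1 else 0
  set G : Fin (n + 1) × ℕ × Fin w.length → Set (Sample n) := fun p =>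
    (fun ω => (hits (A p.2) (ω.1 p.1)).encard) ⁻¹' {(c p : ℕ∞)} with hG
  set E : ℕ → Set (Sample n) := fun m =>
    {ω | Spells w ((z m * w.length : ℤ) : ℝ) ω} with hE
  have hGm : ∀ p, MeasurableSet (G p) := fun p =>
    ((measurable_encard_hits (hA p.2)).comp (measurable_clock p.1))
      (show MeasurableSet {(c p : ℕ∞)} from trivial)
  have hGmeas : ∀ p, sampleLaw ρ (G p) = poissonMeasure (ρ p.1).toNNReal {c p} := fun p => by
    have h1 := (measurePreserving_clock hρ p.1).measure_preimage
      (measurableSet_encard_hits_eq (hA p.2) (c p)).nullMeasurableSet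
    rw [clockLaw_encard_eq (hρ p.1) (hA p.2) (by simp [hAdef])] at h1
    refine h1.trans ?_
    simp only [hAdef, Real.volume_Ico, add_sub_cancel_left, ENNReal.ofReal_one, mul_one]
    rfl
  -- Intersections of block events are finite intersections of independent count events, so
  -- probabilities multiply at once.
  have hGE : ∀ S : Finset ℕ, ⋂ m ∈ S, E m =
      ⋂ p ∈ (Finset.univ ×ˢ S ×ˢ Finset.univ : Finset (Fin (n + 1) × ℕ × Fin w.length)), G p :=
    fun S => by
      ext ω
      simp only [Set.mem_iInter, Finset.mem_product, Finset.mem_univ, true_and, and_true]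
      exact ⟨fun h p hp => h p.2.1 hp p.1 p.2.2, fun h m hm k j => h (k, m, j) hm⟩
  have hprod : ∀ S : Finset ℕ, sampleLaw ρ (⋂ m ∈ S, E m) =
      ∏ _m ∈ S, ∏ k, ∏ j : Fin w.length,
        poissonMeasure (ρ k).toNNReal {if w.get j = k then 1 else 0} := fun S => by
    rw [hGE, hind.measure_inter_preimage_eq_mul _ fun p _ =>
      (trivial : MeasurableSet {(c p : ℕ∞)})]
    rw [Finset.prod_congr rfl fun p _ => hGmeas p, Finset.prod_product]
    simp_rw [Finset.prod_product]
    rw [Finset.prod_comm]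
  set q : ℝ≥0∞ := ∏ k, ∏ j : Fin w.length,
    poissonMeasure (ρ k).toNNReal {if w.get j = k then 1 else 0} with hq
  -- A Poisson law of positive mean charges both `0` and `1`.
  have hq0 : q ≠ 0 := by
    refine Finset.prod_ne_zero_iff.2 fun k _ => Finset.prod_ne_zero_iff.2 fun j _ => ?_
    rw [poissonMeasure_singleton]
    have : (0 : ℝ) < (ρ k).toNNReal := by simpa using hρ k
    exact (ENNReal.ofReal_pos.2 (by positivity)).ne'
  have hE1 : ∀ m, sampleLaw ρ (E m) = q := fun m => by
    simpa using hprod {m}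
  have hEm : ∀ m, MeasurableSet (E m) := fun m => by
    have h1 := hGE {m}
    simp only [Finset.mem_singleton, Set.iInter_iInter_eq_left] at h1
    rw [h1]
    exact Finset.measurableSet_biInter _ fun p _ => hGm p
  have hEi : iIndepSet E (sampleLaw ρ) := (iIndepSet_iff_meas_biInter hEm).2 fun S => by
    rw [hprod S]
    exact Finset.prod_congr rfl fun m _ => (hE1 m).symm
  have hlim := measure_limsup_eq_one hEm hEi (by
    simp_rw [hE1]
    exact ENNReal.tsum_const_eq_top_of_ne_zero hq0)
  have hae : ∀ᵐ ω ∂sampleLaw ρ, ω ∈ limsup E atTop :=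
    (prob_compl_eq_zero_iff (MeasurableSet.measurableSet_limsup hEm)).2 hlim
  filter_upwards [hae] with ω hω
  exact (mem_limsup_iff_frequently_mem.1 hω).exists

/-! ### Synchronization -/

theorem ae_forward_synchronization (hρ : ∀ k, 0 < ρ k) :
    ∀ᵐ ω : Sample n ∂sampleLaw ρ, ∃ T : ℝ≥0, ∀ t : ℝ≥0, T ≤ t →
      ∃ a : State n, (Set.range fun x => φ t x ω) = {a} := by
  obtain ⟨w, a, hw⟩ := exists_synchronizing_word n
  filter_upwards [ae_exists_spells hρ w (z := fun m : ℕ => (m : ℤ)) Nat.cast_injective]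
    with ω ⟨m, hm⟩
  have hτ : (((m : ℤ) * w.length : ℤ) : ℝ) = (((m * w.length : ℕ) : ℝ≥0) : ℝ) := by
    push_cast
    ring
  rw [hτ] at hm
  -- The end of the spelled block; from then on the state no longer depends on `x`.
  refine ⟨(w.length : ℝ≥0) + ((m * w.length : ℕ) : ℝ≥0), fun t ht => ?_⟩
  set T := (w.length : ℝ≥0) + ((m * w.length : ℕ) : ℝ≥0)
  have h1 : ∀ x, φ t x ω = φ (t - T) a (θ T ω) := fun x => by
    conv_lhs => rw [← tsub_add_cancel_of_le ht, φ_add, φ_add, hm.shift.φ_eq, hw]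
  refine ⟨φ (t - T) a (θ T ω), ?_⟩
  simp_rw [h1]
  exact Set.range_const

theorem ae_pullbackLimit_singleton (hρ : ∀ k, 0 < ρ k) :
    ∀ᵐ ω : Sample n ∂sampleLaw ρ, ∃ a : State n, RDS.pullbackLimit θ φ ω = {a} := by
  obtain ⟨w, a, hw⟩ := exists_synchronizing_word n
  filter_upwards [ae_exists_spells hρ w (z := fun m : ℕ => -((m : ℤ) + 1))
    negSucc_cast_injective] with ω ⟨m, hm⟩
  -- Minus the start of the block. The block ends at `-(m * w.length) ≤ 0`, so a run from time `-s`
  -- has forgotten its initial state by time `0`.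
  set s : ℝ≥0 := ((m * w.length : ℕ) : ℝ≥0) + (w.length : ℝ≥0) with hs
  have hτ : ((-((m : ℤ) + 1) * w.length : ℤ) : ℝ) = -(s : ℝ) := by
    rw [hs]
    push_cast
    ring
  rw [hτ] at hm
  have h1 : ∀ x, φ s x (θ (-(s : ℝ)) ω) =
      φ ((m * w.length : ℕ) : ℝ≥0) a (θ ((w.length : ℝ≥0) : ℝ) (θ (-(s : ℝ)) ω)) := fun x => by
    conv_lhs => rw [hs, φ_add, ← hs, hm.shift.φ_eq, hw]
  set b := φ ((m * w.length : ℕ) : ℝ≥0) a (θ ((w.length : ℝ≥0) : ℝ) (θ (-(s : ℝ)) ω))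
  refine ⟨b, (RDS.pullbackLimit_nonempty θ_add φ_add ω).subset_singleton_iff.1 ?_⟩
  refine (Set.iInter_subset _ s).trans ?_
  rintro _ ⟨x, rfl⟩
  exact h1 x

theorem isStrictlyInvariant_pullbackLimit (P : Measure (Sample n)) :
    RDS.IsStrictlyInvariant P θ φ (RDS.pullbackLimit (θ (n := n)) φ) :=
  ae_of_all _ fun ω t => RDS.image_pullbackLimit θ_zero θ_add φ_add ω t

theorem isGlobalPullbackAttractor (P : Measure (Sample n)) :
    RDS.IsGlobalPullbackAttractor P θ φ (RDS.pullbackLimit (θ (n := n)) φ) where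
  randomSet := isCompactRandomSet_pullbackLimit
  invariant := isStrictlyInvariant_pullbackLimit P
  attracts := ae_of_all _ fun ω => by
    obtain ⟨T, hT⟩ := RDS.exists_range_eq_pullbackLimit θ_add φ_add ω
    refine tendsto_const_nhds.congr' ?_
    filter_upwards [eventually_ge_atTop T] with t ht
    rw [hT t ht, RDS.semiDist_self]

/-- Once the image of `X` is a single point, invariance places the nonempty set `A(θ t ω)` inside
it, so the two coincide and their distance is exactly zero. -/
theorem isGlobalForwardAttractor (hρ : ∀ k, 0 < ρ k) :
    RDS.IsGlobalForwardAttractor (sampleLaw ρ) θ φ (RDS.pullbackLimit (θ (n := n)) φ) where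
  randomSet := isCompactRandomSet_pullbackLimit
  invariant := isStrictlyInvariant_pullbackLimit _
  attracts := by
    filter_upwards [ae_forward_synchronization hρ] with ω ⟨T, hT⟩
    refine tendsto_const_nhds.congr' ?_
    filter_upwards [eventually_ge_atTop T] with t ht
    obtain ⟨a, ha⟩ := hT t ht
    have h1 : RDS.pullbackLimit θ φ (θ t ω) = {a} := by
      refine (RDS.pullbackLimit_nonempty θ_add φ_add _).subset_singleton_iff.1 ?_
      rw [← RDS.image_pullbackLimit θ_zero θ_add φ_add, ← ha]
      exact Set.image_subset_range _ _
    rw [h1, ha, RDS.semiDist_self]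

end TASEP

theorem mainTheorem1 (n : ℕ) (hn : 1 ≤ n) (α β : ℝ) (hα : 0 < α) (hβ : 0 < β) (h : ℕ → ℝ)
    (hh : ∀ k, 1 ≤ k → k < n → 0 < h k) :
    -- the clocks are independent homogeneous Poisson processes with the prescribed rates
    (∀ k : Fin (n + 1), IsHomogeneousPoissonProcess (TASEP.law n α β h)
      (fun ω => TASEP.points (ω.1 k)) (TASEP.rate n α β h k)) ∧
    iIndepFun (fun (k : Fin (n + 1)) (ω : TASEP.Sample n) => ω.1 k) (TASEP.law n α β h) ∧
    -- the shift translates all jump times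
    (∀ (t : ℝ) (ω : TASEP.Sample n) (k : Fin (n + 1)),
      TASEP.points ((TASEP.θ t ω).1 k) = (fun s => s - t) '' TASEP.points (ω.1 k)) ∧
    -- TASEP is a random dynamical system over the shift
    RDS.IsRDS (TASEP.law n α β h) TASEP.θ (TASEP.φ (n := n)) ∧
    -- the pullback limit sets form a global random attractor in both senses
    RDS.IsGlobalForwardAttractor (TASEP.law n α β h) TASEP.θ (TASEP.φ (n := n))
      (RDS.pullbackLimit TASEP.θ TASEP.φ) ∧
    RDS.IsGlobalPullbackAttractor (TASEP.law n α β h) TASEP.θ (TASEP.φ (n := n))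
      (RDS.pullbackLimit TASEP.θ TASEP.φ) ∧
    -- they are almost surely singletons
    (∀ᵐ ω ∂(TASEP.law n α β h), ∃ a : TASEP.State n,
      RDS.pullbackLimit TASEP.θ TASEP.φ ω = {a}) ∧
    -- all trajectories synchronize almost surely, for every starting time
    (∀ t₀ : ℝ, ∀ᵐ ω ∂(TASEP.law n α β h), ∃ T : ℝ≥0, ∀ t : ℝ≥0, T ≤ t →
      ∃ a : TASEP.State n, (Set.range fun x => TASEP.φ t x (TASEP.θ t₀ ω)) = {a}) := by
  have hρ : ∀ k, 0 < TASEP.rate n α β h k := TASEP.rate_pos hα hβ hh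
  refine ⟨TASEP.isHomogeneousPoissonProcess_points hρ, TASEP.iIndepFun_clocks hρ,
    fun t ω k => TASEP.points_shiftClock t (ω.1 k), TASEP.isRDS hρ,
    TASEP.isGlobalForwardAttractor hρ, TASEP.isGlobalPullbackAttractor _,
    TASEP.ae_pullbackLimit_singleton hρ, fun t₀ => ?_⟩
  -- The almost sure event for start at time `0` is pulled back along `θ t₀`, which preserves the
  -- measure.
  exact (TASEP.measurePreserving_θ hρ t₀).quasiMeasurePreserving.ae
    (TASEP.ae_forward_synchronization hρ)
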